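/- Let $1\le k\le m$ and $n\ge 1$ be integers. For $z,w\in\mathbb C^m$ let $$\Pi(z,w)=\pi^{-m}\exp\big(i\,\mathrm{Im}(z\cdot\bar w)-\tfrac12|z-w|^2\big),\qquad z\cdot\bar w=\sum_q z_q\bar w_q,$$ be the level one Szegő kernel $\Pi^{\mathbf H}_1(z,0;w,0)$ of the reduced Heisenberg group. For distinct points $z^1,\dots,z^n\in\mathbb C^m$ define the matrices (with $1\le p,p'\le n$, $1\le q,q'\le m$) $$A^p_{p'}=\Pi(z^p,z^{p'}),\qquad B^p_{p'q'}=(z^p_{q'}-z^{p'}_{q'})\,\Pi(z^p,z^{p'}),\qquad C^{pq}_{p'q'}=\big(\delta_{qq'}+(\bar z^{p'}_q-\bar z^p_q)(z^p_{q'}-z^{p'}_{q'})\big)\Pi(z^p,z^{p'}),$$ and $\Lambda=C-B^*A^{-1}B$. For a positive semidefinite complex matrix $S$ let $\gamma_S$ be the centred complex Gaussian measure with $\mathbf E\,\xi_a\bar\xi_b=S_{ab}$ and $\mathbf E\,\xi_a\xi_b=0$. The $n$-point scaling limit zero correlation function of codimension $k$ in dimension $m$ is $$K^\infty_{nkm}(z^1,\dots,z^n)=\frac{1}{[\pi^n\det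 A]^k}\int_{\mathbb C^{kmn}}\prod_{p=1}^n\det_{1\le j,j'\le k}\Big(\sum_{q=1}^m\xi^p_{jq}\bar\xi^p_{j'q}\Big)\,d\gamma_{I_k\otimes\Lambda}(\xi),$$ its normalization is $\widetilde K^\infty_{nkm}=\big(\pi^k(m-k)!/m!\big)^nK^\infty_{nkm}$, and the connected correlation function is $$\widetilde T^\infty_{nkm}(z^1,\dots,z^n)=\sum_{G}(-1)^{l+1}(l-1)!\prod_{j=1}^l\widetilde K^\infty_{n_jkm}(z^{p_{j1}},\dots,z^{p_{jn_j}}),$$ the sum being over all partitions $G=(G_1,\dots,G_l)$ of $\{1,\dots,n\}$ into nonempty blocks, $G_j=\{p_{j1},\dots,p_{jn_j}\}$. Put $R=R(z)=\max_{p,q}|z^p-z^q|$ and let $c>0$. Then, for configurations $z=(z^1,\dots,z^n)$ with $\min_{p\neq q}|z^p-z^q|\ge c$: 1. $\widetilde T^\infty_{nkm}(z^1,\dots,z^n)=o\big(e^{-R^2/n}\big)$ as $R\to\infty$, that is, for every $\varepsilon>0$ there is $R_0$ (depending only on $\varepsilon,n,k,m,c$) such that $|\widetilde T^\infty_{nkm}(z)|\le\varepsilon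 e^{-R^2/n}$ for all such $z$ with $R(z)\ge R_0$; 2. if $n\ge2$, then $\widetilde T^\infty_{nkm}(z^1,\dots,z^n)=O\big(R^{4n-4}e^{-R^2/(n-1)}\big)$, that is, there is a constant $C$ (depending only on $n,k,m,c$) with $|\widetilde T^\infty_{nkm}(z)|\le C\,R^{4n-4}e^{-R^2/(n-1)}$ for all such $z$. -/

import Mathlib

open MeasureTheory ProbabilityTheory Matrix Asymptotics Filter
open scoped MatrixOrder Kronecker Nat

noncomputable section

namespace ZeroCorrelations

/-! ### Complex Gaussian measures -/

/-- The standard complex Gaussian law on `ℂ`: real and imaginary parts are independent, centred,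
of variance `1/2`, so that `E w = E w² = 0` and `E |w|² = 1`. -/
def stdComplexGaussian : Measure ℂ :=
  ((gaussianReal 0 (1 / 2)).prod (gaussianReal 0 (1 / 2))).map
    fun x : ℝ × ℝ => (⟨x.1, x.2⟩ : ℂ)

/-- The (generalized, i.e. possibly degenerate) centred complex Gaussian measure `γ_S` on `ℂ^κ`
with positive semidefinite covariance matrix `S`, i.e. `E ξ_a ξ_b = 0` and
`E ξ_a conj ξ_b = S a b`: the image under `S^{1/2}` of the law of independent standard complex
Gaussians. -/
def complexGaussian {κ : Type*} [Fintype κ] [DecidableEq κ] (S : Matrix κ κ ℂ) :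
    Measure (κ → ℂ) :=
  (Measure.pi fun _ : κ => stdComplexGaussian).map fun w => CFC.sqrt S *ᵥ w

/-! ### The Szegő kernel of the reduced Heisenberg group and the limit covariance matrices -/

section Covariance

variable {m : ℕ}

/-- The level one Szegő kernel of the reduced Heisenberg group,
`Π(z,s;w,t) = π^{-m} exp(i(s-t) + i Im(z · w̄) - |z-w|²/2)`. -/
def heisenbergSzego (z : EuclideanSpace ℂ (Fin m)) (s : ℝ) (w : EuclideanSpace ℂ (Fin m))
    (t : ℝ) : ℂ :=
  1 / (Real.pi : ℂ) ^ m *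
    Complex.exp (Complex.I * ((s : ℂ) - (t : ℂ))
      + Complex.I * ((∑ q, z q * star (w q)).im : ℂ) - ((‖z - w‖ ^ 2 / 2 : ℝ) : ℂ))

variable {ι : Type*}

/-- Covariances of the values of the section at the points `z p`. -/
def covA (z : ι → EuclideanSpace ℂ (Fin m)) : Matrix ι ι ℂ :=
  Matrix.of fun p p' => heisenbergSzego (z p) 0 (z p') 0

/-- Covariances of the values with the (holomorphic) derivatives. -/
def covB (z : ι → EuclideanSpace ℂ (Fin m)) : Matrix ι (ι × Fin m) ℂ :=
  Matrix.of fun p b => (z p b.2 - z b.1 b.2) * heisenbergSzego (z p) 0 (z b.1) 0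

/-- Covariances of the (holomorphic) derivatives. -/
def covC (z : ι → EuclideanSpace ℂ (Fin m)) : Matrix (ι × Fin m) (ι × Fin m) ℂ :=
  Matrix.of fun a b =>
    ((if a.2 = b.2 then 1 else 0)
        + (star (z b.1 a.2) - star (z a.1 a.2)) * (z a.1 b.2 - z b.1 b.2))
      * heisenbergSzego (z a.1) 0 (z b.1) 0

/-- `Λ = C - B^* A⁻¹ B`, the covariance of the derivatives conditioned on the vanishing of the
values. -/
def covLambda [Fintype ι] [DecidableEq ι] (z : ι → EuclideanSpace ℂ (Fin m)) :
    Matrix (ι × Fin m) (ι × Fin m) ℂ :=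
  covC z - (covB z)ᴴ * (covA z)⁻¹ * covB z

/-! ### The correlation functions -/

/-- The scaling limit zero correlation function `K^∞_{nkm}` at the points `z p`, `p ∈ ι`, where
`n` is the number of elements of `ι` (the function is symmetric, so no order of the points is
needed).  It is a real number, here regarded as an element of `ℂ`. -/
def zeroCorr [Fintype ι] [DecidableEq ι] (k : ℕ) (z : ι → EuclideanSpace ℂ (Fin m)) : ℂ :=
  1 / ((Real.pi : ℂ) ^ Fintype.card ι * (covA z).det) ^ k *
    ∫ ξ : Fin k × (ι × Fin m) → ℂ,
      ∏ p : ι, (Matrix.of fun j j' : Fin k => ∑ q : Fin m, ξ (j, p, q) * star (ξ (j', p, q))).det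
      ∂complexGaussian ((1 : Matrix (Fin k) (Fin k) ℂ) ⊗ₖ covLambda z)

/-- The normalized correlation function `(K^∞_{1km})^{-n} K^∞_{nkm}`, where
`K^∞_{1km} = m! / (π^k (m-k)!)`. -/
def normalizedCorr [Fintype ι] [DecidableEq ι] (k : ℕ) (z : ι → EuclideanSpace ℂ (Fin m)) : ℂ :=
  ((Real.pi : ℂ) ^ k * ((m - k)! : ℂ) / (m ! : ℂ)) ^ Fintype.card ι * zeroCorr k z

/-- The connected (truncated) correlation function: the sum over all partitions `G` of the index
set into `l` blocks of `(-1)^{l+1} (l-1)!` times the product over the blocks of the normalized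
correlation functions of the points in the block. -/
def connectedCorr [Fintype ι] [DecidableEq ι] (k : ℕ) (z : ι → EuclideanSpace ℂ (Fin m)) : ℂ :=
  ∑ G : Finpartition (Finset.univ : Finset ι),
    (-1) ^ (G.parts.card + 1) * ((G.parts.card - 1)! : ℂ) *
      ∏ S ∈ G.parts, normalizedCorr k (fun p : S => z p)

/-- The maximal distance `R` between two of the points. -/
def maxDist (z : ι → EuclideanSpace ℂ (Fin m)) : ℝ :=
  Metric.diam (Set.range z)

/-- The configurations in which different points are at distance at least `c`. -/
def separated (m : ℕ) (ι : Type*) (c : ℝ) : Set (ι → EuclideanSpace ℂ (Fin m)) :=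
  {z | ∀ p q, p ≠ q → c ≤ dist (z p) (z q)}

end Covariance

end ZeroCorrelations

end

open ZeroCorrelations

/-! Write $M$ for the joint covariance matrix of values and derivatives at the points, and $N=n-1$.
By Wick's formula the Gaussian integral is a sum of signed permanents in the entries of $\Lambda$,
and $\Lambda$ is a Schur complement in $M$. So each correlation function is rational in the entries
of $M$, with a power of $\det A$ as denominator, and the connected one is a polynomial `ursellPoly`
evaluated at $M$ over a product of such powers.

Denominators: on separated configurations $\det A$ is bounded below uniformly (`le_norm_det_covA`).
In Bargmann–Fock space, a polynomial equal to 1 at one point and 0 at the others has norm controlled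
by $c$ and $n$ alone, which bounds the least eigenvalue of $A$.

Numerator: if all entries of a generic $M$ from a set $S$ of points to its complement vanish, the
correlations factor across the cut and the connected one is zero (`ursell_eq_zero`). One direction
is enough, since determinants and permanents of block triangular matrices factor. Here $M$ is not
assumed Hermitian: its entries are independent variables. Hence every monomial of `ursellPoly`
contains, for each nontrivial cut, an edge crossing it in each direction.

Decay: an entry between points at distance $d$ is at most $(1+d)^2e^{-d^2/2}$. Project the points to
the line through two of them at distance $R$. Each of the $N$ gaps is crossed by a rightward and a
leftward edge of the monomial; in each direction the chosen edges have total squared length at least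
the sum of the squared gaps, which is at least $R^2/N$. At most $2N$ edges of total squared length
at least $2R^2/N$ give $(1+R)^{4N}e^{-R^2/N}$, the second claim. The first follows because
$1/N>1/(N+1)$. -/

section Ursell

/-! ### Ursell functions as linear coefficients of weighted chromatic polynomials. -/

open Finset

/-- A partition together with an injective colouring of its blocks is the same as a colouring. -/
theorem Finpartition.bijective_colouring {V C : Type*} [Fintype V] [DecidableEq V] :
    Function.Bijective
      (fun (x : Σ G : Finpartition (univ : Finset V), (G.parts ↪ C)) (v : V) =>
        x.2 ⟨x.1.part v, x.1.part_mem.2 (mem_univ v)⟩) := by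
  classical
  constructor
  · rintro ⟨G, e⟩ ⟨H, e'⟩ h
    have key : ∀ (G : Finpartition (univ : Finset V)) (e : G.parts ↪ C) (v w : V),
        e ⟨G.part v, G.part_mem.2 (mem_univ v)⟩ = e ⟨G.part w, G.part_mem.2 (mem_univ w)⟩
          ↔ w ∈ G.part v := by
      intro G e v w
      rw [e.injective.eq_iff, Subtype.mk.injEq, G.mem_part_iff_part_eq_part (mem_univ w) (mem_univ v),
        eq_comm]
    have hpart : ∀ v, G.part v = H.part v := by
      intro v
      ext w
      rw [← key G e v w, ← key H e' v w]
      have h1 := congrFun h v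
      have h2 := congrFun h w
      simp only at h1 h2
      rw [h1, h2]
    have hGH : G = H := by
      ext B
      constructor
      · intro hB
        obtain ⟨v, hv⟩ := G.nonempty_of_mem_parts hB
        rw [← G.part_eq_of_mem hB hv, hpart]
        exact H.part_mem.2 (mem_univ v)
      · intro hB
        obtain ⟨v, hv⟩ := H.nonempty_of_mem_parts hB
        rw [← H.part_eq_of_mem hB hv, ← hpart]
        exact G.part_mem.2 (mem_univ v)
    subst hGH
    congr 1
    ext ⟨B, hB⟩
    obtain ⟨v, hv⟩ := G.nonempty_of_mem_parts hB
    have h1 := congrFun h v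
    simp only [G.part_eq_of_mem hB hv] at h1
    exact h1
  · intro f
    let G : Finpartition (univ : Finset V) := Finpartition.ofSetoid (Setoid.ker f)
    have hG : ∀ v w, w ∈ G.part v ↔ f v = f w := fun v w =>
      Finpartition.mem_part_ofSetoid_iff_rel
    have hne : ∀ B : G.parts, (B : Finset V).Nonempty := fun B => G.nonempty_of_mem_parts B.2
    let r : G.parts → V := fun B => (hne B).choose
    have hr : ∀ B : G.parts, r B ∈ (B : Finset V) := fun B => (hne B).choose_spec
    refine ⟨⟨G, ⟨fun B => f (r B), ?_⟩⟩, ?_⟩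
    · intro B B' h
      have h1 := (hG (r B) (r B')).2 h
      rw [G.part_eq_of_mem B.2 (hr B)] at h1
      exact Subtype.ext (G.eq_of_mem_parts B.2 B'.2 h1 (hr B'))
    · ext v
      exact ((hG v _).1 (hr ⟨G.part v, G.part_mem.2 (mem_univ v)⟩)).symm

variable {L : Type*} [Field L]

/-- The sum over all colourings of the product over the colours of the weights of the colour
classes. -/
def colourSum {V : Type*} [Fintype V] [DecidableEq V] (κ : Finset V → L) (t : ℕ) : L :=
  ∑ f : V → Fin t, ∏ c, κ (univ.filter fun v => f v = c)

/-- The chromatic polynomial whose value at `t` is `colourSum κ t`. -/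
noncomputable def colourPoly {V : Type*} [Fintype V] [DecidableEq V] (κ : Finset V → L) : Polynomial L :=
  ∑ G : Finpartition (univ : Finset V), Polynomial.C (∏ B ∈ G.parts, κ B) *
    descPochhammer L #G.parts

/-- Group the colourings by their partition into colour classes. Unused colours contribute `κ ∅ =
1`, and the injective colourings of the blocks are counted by a falling factorial. -/
theorem eval_colourPoly {V : Type*} [Fintype V] [DecidableEq V] (κ : Finset V → L)
    (h0 : κ ∅ = 1) (t : ℕ) : (colourPoly κ).eval (t : L) = colourSum κ t := by
  classical
  rw [colourSum, ← Fintype.sum_bijective _ (Finpartition.bijective_colouring (V := V)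
    (C := Fin t)) _ _ (fun _ => rfl), Fintype.sum_sigma, colourPoly, Polynomial.eval_finsetSum]
  refine sum_congr rfl fun G _ => ?_
  have : ∀ e : G.parts ↪ Fin t, ∏ c, κ (univ.filter fun v =>
      e ⟨G.part v, G.part_mem.2 (mem_univ v)⟩ = c) = ∏ B ∈ G.parts, κ B := by
    intro e
    rw [← prod_subset (subset_univ (univ.map e)), prod_map, ← prod_coe_sort G.parts]
    · refine prod_congr rfl fun B _ => ?_
      congr 1
      ext v
      simp only [mem_filter, mem_univ, true_and, e.injective.eq_iff]
      rw [Subtype.ext_iff]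
      constructor
      · intro h
        rw [← h]
        exact G.mem_part (mem_univ v)
      · exact fun h => G.part_eq_of_mem B.2 h
    · intro c _ hc
      rw [filter_eq_empty_iff.2, h0]
      intro v _ hv
      exact hc (mem_map.2 ⟨_, mem_univ _, hv⟩)
  simp_rw [this]
  rw [sum_const, card_univ, Fintype.card_embedding_eq, Fintype.card_coe, Fintype.card_fin,
    Polynomial.eval_mul, Polynomial.eval_C, descPochhammer_eval_eq_descFactorial, nsmul_eq_mul,
    mul_comm]

theorem eval_neg_one_descPochhammer (n : ℕ) :
    (descPochhammer L n).eval (-1) = (-1) ^ n * (n ! : L) := by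
  induction n with
  | zero => simp
  | succ n ih =>
    rw [descPochhammer_succ_right, Polynomial.eval_mul, ih, Nat.factorial_succ]
    simp
    ring

/-- Since $(X)_n = X\,(X-1)_{n-1}$, the linear coefficient is the value of $(X)_{n-1}$ at $-1$. It
is exactly the weight of an $n$-block partition in the connected correlation. -/
theorem coeff_one_descPochhammer {n : ℕ} (hn : n ≠ 0) :
    (descPochhammer L n).coeff 1 = (-1) ^ (n + 1) * ((n - 1)! : L) := by
  obtain ⟨n, rfl⟩ := Nat.exists_eq_succ_of_ne_zero hn
  rw [Nat.succ_eq_add_one, descPochhammer_succ_left, Polynomial.coeff_X_mul,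
    Polynomial.coeff_zero_eq_eval_zero, Polynomial.eval_comp]
  simp only [Polynomial.eval_sub, Polynomial.eval_X, Polynomial.eval_one, zero_sub,
    eval_neg_one_descPochhammer, Nat.add_sub_cancel]
  ring

theorem Finpartition.card_parts_univ_ne_zero {V : Type*} [Fintype V] [DecidableEq V] [Nonempty V]
    (G : Finpartition (univ : Finset V)) : #G.parts ≠ 0 := by
  rw [Ne, card_eq_zero, G.parts_eq_empty_iff]
  exact univ_nonempty.ne_empty

theorem coeff_zero_colourPoly {V : Type*} [Fintype V] [DecidableEq V] [Nonempty V]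
    (κ : Finset V → L) : (colourPoly κ).coeff 0 = 0 := by
  rw [colourPoly, Polynomial.finsetSum_coeff]
  refine sum_eq_zero fun G _ => ?_
  rw [Polynomial.coeff_C_mul, Polynomial.coeff_zero_eq_eval_zero, descPochhammer_eval_zero,
    if_neg G.card_parts_univ_ne_zero, mul_zero]

theorem coeff_one_colourPoly {V : Type*} [Fintype V] [DecidableEq V] [Nonempty V]
    (κ : Finset V → L) : (colourPoly κ).coeff 1 =
      ∑ G : Finpartition (univ : Finset V), (-1) ^ (#G.parts + 1) * ((#G.parts - 1)! : L) *
        ∏ B ∈ G.parts, κ B := by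
  rw [colourPoly, Polynomial.finsetSum_coeff]
  refine sum_congr rfl fun G _ => ?_
  rw [Polynomial.coeff_C_mul, coeff_one_descPochhammer G.card_parts_univ_ne_zero, mul_comm]

/-- The Ursell function of a weight that is multiplicative across a nontrivial splitting
vanishes. -/
theorem ursell_eq_zero [CharZero L] {V : Type*} [Fintype V] [DecidableEq V] (κ : Finset V → L)
    (h0 : κ ∅ = 1) (S : Finset V) (hS : S.Nonempty) (hS' : Sᶜ.Nonempty)
    (hκ : ∀ s t : Finset V, s ⊆ S → t ⊆ Sᶜ → κ (s ∪ t) = κ s * κ t) :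
    ∑ G : Finpartition (univ : Finset V), (-1) ^ (#G.parts + 1) * ((#G.parts - 1)! : L) *
        ∏ B ∈ G.parts, κ B = 0 := by
  classical
  obtain ⟨a, ha⟩ := hS
  obtain ⟨b, hb⟩ := hS'
  have hb' : b ∉ S := mem_compl.1 hb
  have : Nonempty V := ⟨a⟩
  have : Nonempty {x // x ∈ S} := ⟨⟨a, ha⟩⟩
  have : Nonempty {x // ¬ x ∈ S} := ⟨⟨b, hb'⟩⟩
  let κ₁ : Finset {x // x ∈ S} → L := fun W => κ (W.map (Function.Embedding.subtype _))
  let κ₂ : Finset {x // ¬ x ∈ S} → L := fun W => κ (W.map (Function.Embedding.subtype _))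
  have hZ : ∀ t, colourSum κ t = colourSum κ₁ t * colourSum κ₂ t := by
    intro t
    rw [colourSum, colourSum, colourSum, sum_mul_sum, ← Fintype.sum_prod_type',
      ← (Equiv.piEquivPiSubtypeProd (fun x => x ∈ S) (fun _ => Fin t)).sum_comp]
    refine sum_congr rfl fun f _ => ?_
    rw [← prod_mul_distrib]
    refine prod_congr rfl fun c _ => ?_
    rw [← hκ]
    · congr 1
      ext v
      by_cases hv : v ∈ S <;> simp [Equiv.piEquivPiSubtypeProd, hv]
    · intro v hv
      obtain ⟨w, _, rfl⟩ := mem_map.1 hv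
      exact w.2
    · intro v hv
      obtain ⟨w, _, rfl⟩ := mem_map.1 hv
      exact mem_compl.2 w.2
  -- A colouring of `V` is a pair of colourings of `S` and its complement, so the two sides agree at
  -- every natural number, hence identically in characteristic zero.
  have hP : colourPoly κ = colourPoly κ₁ * colourPoly κ₂ := by
    refine Polynomial.eq_of_infinite_eval_eq _ _ ((Set.infinite_range_of_injective
      (Nat.cast_injective (R := L))).mono ?_)
    rintro _ ⟨t, rfl⟩
    simp only [Set.mem_ofPred_eq, Polynomial.eval_mul]
    rw [eval_colourPoly κ h0, eval_colourPoly κ₁ (by simpa [κ₁] using h0),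
      eval_colourPoly κ₂ (by simpa [κ₂] using h0), hZ]
  -- Both factors have zero constant term, so their product has no linear term.
  rw [← coeff_one_colourPoly, hP, Polynomial.coeff_mul]
  simp [Nat.antidiagonal_succ, coeff_zero_colourPoly]

end Ursell

/-! ### Permanents of block triangular matrices. -/

section Permanent

open Equiv Finset

variable {m n R : Type*} [Fintype m] [DecidableEq m] [Fintype n] [DecidableEq n] [CommRing R]

/-- As for determinants, without the signs: a permutation not preserving the left summand picks an
entry of the zero block. -/
theorem Matrix.permanent_fromBlocks_zero₂₁ (A : Matrix m m R) (B : Matrix m n R)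
    (D : Matrix n n R) :
    (Matrix.fromBlocks A B 0 D).permanent = A.permanent * D.permanent := by
  classical
  simp_rw [permanent]
  convert!
    Eq.symm <|
      sum_subset (M := R)
        (subset_univ ((Perm.sumCongrHom m n).range : Set (Perm (m ⊕ n))).toFinset) ?_
  · simp_rw [sum_mul_sum, ← sum_product', univ_product_univ]
    refine sum_nbij (fun σ ↦ σ.fst.sumCongr σ.snd) ?_ ?_ ?_ ?_
    · intro σ₁₂ _
      exact Set.mem_toFinset.2 ⟨σ₁₂, rfl⟩
    · intro σ₁ _ σ₂ _
      dsimp only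
      intro h
      have h2 : ∀ x, Perm.sumCongr σ₁.fst σ₁.snd x = Perm.sumCongr σ₂.fst σ₂.snd x :=
        DFunLike.congr_fun h
      simp only [Sum.map_inr, Sum.map_inl, Perm.sumCongr_apply, Sum.forall, Sum.inl.injEq,
        Sum.inr.injEq] at h2
      ext x
      · exact h2.left x
      · exact h2.right x
    · intro σ hσ
      rw [mem_coe, Set.mem_toFinset] at hσ
      obtain ⟨σ₁₂, hσ₁₂⟩ := hσ
      use σ₁₂
      rw [← hσ₁₂]
      simp
    · simp only [forall_prop_of_true, Prod.forall, mem_univ]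
      intro σ₁ σ₂
      rw [Fintype.prod_sum_type]
      simp_rw [Equiv.sumCongr_apply, Sum.map_inr, Sum.map_inl, fromBlocks_apply₁₁,
        fromBlocks_apply₂₂]
  · rintro σ - hσn
    have h1 : ¬∀ x, ∃ y, Sum.inl y = σ (Sum.inl x) := by
      rw [Set.mem_toFinset] at hσn
      simpa only [Set.MapsTo, Set.mem_range, forall_exists_index, forall_apply_eq_imp_iff] using
        mt Perm.mem_sumCongrHom_range_of_perm_mapsTo_inl hσn
    obtain ⟨a, ha⟩ := not_forall.mp h1
    rcases hx : σ (Sum.inl a) with a2 | b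
    · have hn := (not_exists.mp ha) a2
      exact absurd hx.symm hn
    · rw [Finset.prod_eq_zero (Finset.mem_univ (Sum.inl a))]
      rw [hx, fromBlocks_apply₂₁, zero_apply]

theorem Matrix.permanent_fromBlocks_zero₁₂ (A : Matrix m m R) (C : Matrix n m R)
    (D : Matrix n n R) :
    (Matrix.fromBlocks A 0 C D).permanent = A.permanent * D.permanent := by
  rw [← permanent_transpose, fromBlocks_transpose, transpose_zero, permanent_fromBlocks_zero₂₁,
    permanent_transpose, permanent_transpose]

theorem Matrix.permanent_submatrix_equiv_self (e : n ≃ m) (A : Matrix m m R) :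
    (A.submatrix e e).permanent = A.permanent := by
  simp_rw [permanent]
  rw [← e.permCongr.sum_comp]
  refine sum_congr rfl fun σ _ => ?_
  rw [← e.prod_comp]
  simp [Equiv.permCongr_apply]

end Permanent

/-! ### The Wick expansion as a polynomial in the covariances. -/

section Wick

open Finset

variable {ι α β R : Type*} [Fintype ι] [DecidableEq ι] [Fintype α] [DecidableEq α] [Fintype β]
  [DecidableEq β] [CommRing R] {k m : ℕ}

/-- The matrix of covariances of the factors selected by `ω` in the expansion of the product of
determinants. -/
def choiceMatrix (Λ : Matrix (ι × Fin m) (ι × Fin m) R)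
    (ω : ι → Equiv.Perm (Fin k) × (Fin k → Fin m)) : Matrix (ι × Fin k) (ι × Fin k) R :=
  Matrix.of fun a b => if (ω a.1).1 a.2 = b.2 then
    Λ (a.1, (ω a.1).2 a.2) (b.1, (ω b.1).2 b.2) else 0

/-- The value given by the Wick formula for the expectation of the product of the determinants
`det (∑ q, ξ (j, p, q) * conj (ξ (j', p, q)))` under the Gaussian measure with covariance
`1 ⊗ₖ Λ`. -/
def wick (k : ℕ) (Λ : Matrix (ι × Fin m) (ι × Fin m) R) : R :=
  ∑ ω : ι → Equiv.Perm (Fin k) × (Fin k → Fin m),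
    (∏ p, ((Equiv.Perm.sign (ω p).1 : ℤ) : R)) * (choiceMatrix Λ ω).permanent

theorem wick_submatrix_equiv (e : α ≃ ι) (Λ : Matrix (ι × Fin m) (ι × Fin m) R) :
    wick k (Λ.submatrix (Prod.map e id) (Prod.map e id)) = wick k Λ := by
  rw [wick, wick, ← (Equiv.arrowCongr e (Equiv.refl _)).sum_comp]
  refine sum_congr rfl fun ω _ => ?_
  rw [← e.prod_comp, ← permanent_submatrix_equiv_self (e.prodCongr (Equiv.refl _))]
  simp only [Equiv.arrowCongr_apply, Equiv.coe_refl, Function.comp_apply, id,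
    Equiv.symm_apply_apply]
  congr 2
  ext a b
  simp [choiceMatrix]

theorem wick_smul (c : R) (Λ : Matrix (ι × Fin m) (ι × Fin m) R) :
    wick k (c • Λ) = c ^ (Fintype.card ι * k) * wick k Λ := by
  rw [wick, wick, mul_sum]
  refine sum_congr rfl fun ω _ => ?_
  have : choiceMatrix (c • Λ) ω = c • choiceMatrix Λ ω := by
    ext a b
    simp [choiceMatrix]
  rw [this, permanent_smul, Fintype.card_prod, Fintype.card_fin]
  ring

theorem map_wick {R' : Type*} [CommRing R'] (f : R →+* R') (Λ : Matrix (ι × Fin m) (ι × Fin m) R) :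
    f (wick k Λ) = wick k (Λ.map f) := by
  simp only [wick, permanent, choiceMatrix, map_sum, map_mul, map_prod, map_intCast, of_apply,
    apply_ite f, map_zero, Matrix.map_apply]

theorem wick_of_isEmpty [IsEmpty ι] (Λ : Matrix (ι × Fin m) (ι × Fin m) R) : wick k Λ = 1 := by
  simp [wick, permanent]

/-- Vanishing in one direction makes every choice matrix block triangular, so its permanent splits.
-/
theorem wick_sum (Λ : Matrix ((α ⊕ β) × Fin m) ((α ⊕ β) × Fin m) R)
    (h : ∀ a x b y, Λ (Sum.inl a, x) (Sum.inr b, y) = 0) :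
    wick k Λ = wick k (Λ.submatrix (Prod.map Sum.inl id) (Prod.map Sum.inl id)) *
      wick k (Λ.submatrix (Prod.map Sum.inr id) (Prod.map Sum.inr id)) := by
  rw [wick, wick, wick, sum_mul_sum, ← Fintype.sum_prod_type',
    ← (Equiv.sumArrowEquivProdArrow α β _).symm.sum_comp]
  refine sum_congr rfl fun ω _ => ?_
  rw [Fintype.prod_sum_type,
    ← permanent_submatrix_equiv_self (Equiv.sumProdDistrib α β (Fin k)).symm]
  have : (choiceMatrix Λ ((Equiv.sumArrowEquivProdArrow α β _).symm ω)).submatrix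
      (Equiv.sumProdDistrib α β (Fin k)).symm (Equiv.sumProdDistrib α β (Fin k)).symm =
      Matrix.fromBlocks
        (choiceMatrix (Λ.submatrix (Prod.map Sum.inl id) (Prod.map Sum.inl id)) ω.1) 0
        (Matrix.of fun a b => choiceMatrix Λ ((Equiv.sumArrowEquivProdArrow α β _).symm ω)
          (Sum.inr a.1, a.2) (Sum.inl b.1, b.2))
        (choiceMatrix (Λ.submatrix (Prod.map Sum.inr id) (Prod.map Sum.inr id)) ω.2) := by
    ext (a | a) (b | b) <;>
      simp [choiceMatrix, h, Equiv.sumArrowEquivProdArrow]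
    all_goals rfl
  rw [this, permanent_fromBlocks_zero₁₂]
  simp only [Equiv.sumArrowEquivProdArrow, Equiv.coe_fn_symm_mk, Sum.elim_inl, Sum.elim_inr]
  ring

end Wick

/-! ### Correlations as rational functions of an arbitrary covariance matrix. -/

section BlockCorr

open Finset

variable {ι α β R : Type*} [Fintype ι] [DecidableEq ι] [Fintype α] [DecidableEq α] [Fintype β]
  [DecidableEq β] {k m : ℕ}

/-- The block of covariances of the values. -/
def blockA (M : Matrix (ι × Option (Fin m)) (ι × Option (Fin m)) R) : Matrix ι ι R :=
  Matrix.of fun p p' => M (p, none) (p', none)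

/-- The block of covariances of the values with the derivatives. -/
def blockB (M : Matrix (ι × Option (Fin m)) (ι × Option (Fin m)) R) : Matrix ι (ι × Fin m) R :=
  Matrix.of fun p b => M (p, none) (b.1, some b.2)

/-- The block of covariances of the derivatives with the values. -/
def blockB' (M : Matrix (ι × Option (Fin m)) (ι × Option (Fin m)) R) : Matrix (ι × Fin m) ι R :=
  Matrix.of fun a p => M (a.1, some a.2) (p, none)

/-- The block of covariances of the derivatives. -/
def blockC (M : Matrix (ι × Option (Fin m)) (ι × Option (Fin m)) R) :
    Matrix (ι × Fin m) (ι × Fin m) R :=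
  Matrix.of fun a b => M (a.1, some a.2) (b.1, some b.2)

/-- The restriction of a covariance matrix along a map of the index sets. -/
def pullback (e : α → ι) (M : Matrix (ι × Option (Fin m)) (ι × Option (Fin m)) R) :
    Matrix (α × Option (Fin m)) (α × Option (Fin m)) R :=
  M.submatrix (Prod.map e id) (Prod.map e id)

variable [CommRing R]

/-- The Schur complement of the block of the values. -/
noncomputable def schurCompl (M : Matrix (ι × Option (Fin m)) (ι × Option (Fin m)) R) :
    Matrix (ι × Fin m) (ι × Fin m) R :=
  blockC M - blockB' M * (blockA M)⁻¹ * blockB M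

/-- The Schur complement multiplied by the determinant. -/
def schurNum (M : Matrix (ι × Option (Fin m)) (ι × Option (Fin m)) R) :
    Matrix (ι × Fin m) (ι × Fin m) R :=
  (blockA M).det • blockC M - blockB' M * (blockA M).adjugate * blockB M

theorem map_schurNum {R' : Type*} [CommRing R'] (f : R →+* R')
    (M : Matrix (ι × Option (Fin m)) (ι × Option (Fin m)) R) :
    (schurNum M).map f = schurNum (M.map f) := by
  have hA : blockA (M.map f) = f.mapMatrix (blockA M) := rfl
  have hB : blockB (M.map f) = (blockB M).map f := rfl
  have hB' : blockB' (M.map f) = (blockB' M).map f := rfl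
  rw [schurNum, schurNum, hA, hB, hB', ← RingHom.map_det, ← RingHom.map_adjugate,
    RingHom.mapMatrix_apply, ← Matrix.map_mul, ← Matrix.map_mul]
  ext a b
  simp only [Matrix.map_apply, Matrix.sub_apply, Matrix.smul_apply, map_sub, smul_eq_mul, map_mul,
    blockC, of_apply]

variable {L : Type*} [Field L]

/-- The correlation function of a covariance matrix, up to the normalization. -/
noncomputable def blockCorr (k : ℕ) (M : Matrix (ι × Option (Fin m)) (ι × Option (Fin m)) L) : L :=
  ((blockA M).det ^ k)⁻¹ * wick k (schurCompl M)

/-- The Schur complement is `schurNum` over the determinant, and `wick` is homogeneous of degree `k`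
times the number of points. -/
theorem blockCorr_eq_div (M : Matrix (ι × Option (Fin m)) (ι × Option (Fin m)) L)
    (h : (blockA M).det ≠ 0) :
    blockCorr k M = wick k (schurNum M) / (blockA M).det ^ (k + Fintype.card ι * k) := by
  have : schurCompl M = (blockA M).det⁻¹ • schurNum M := by
    rw [schurCompl, schurNum, smul_sub, smul_smul, inv_mul_cancel₀ h, one_smul, Matrix.inv_def,
      Ring.inverse_eq_inv', Matrix.mul_smul, Matrix.smul_mul]
  rw [blockCorr, this, wick_smul, pow_add, inv_pow]
  field_simp

theorem blockCorr_pullback_equiv (e : α ≃ ι)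
    (M : Matrix (ι × Option (Fin m)) (ι × Option (Fin m)) L) :
    blockCorr k (pullback e M) = blockCorr k M := by
  have hA : blockA (pullback e M) = (blockA M).submatrix e e := rfl
  have hC : blockC (pullback e M) = (blockC M).submatrix (Prod.map e id) (Prod.map e id) := rfl
  have hB : blockB (pullback e M) = (blockB M).submatrix e (Prod.map e id) := rfl
  have hB' : blockB' (pullback e M) = (blockB' M).submatrix (Prod.map e id) e := rfl
  rw [blockCorr, blockCorr, schurCompl, hA, hB, hB', hC, det_submatrix_equiv_self,
    inv_submatrix_equiv, submatrix_mul_equiv, submatrix_mul_equiv]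
  exact congrArg _ (wick_submatrix_equiv e (schurCompl M))

theorem blockCorr_of_isEmpty [IsEmpty ι] (M : Matrix (ι × Option (Fin m)) (ι × Option (Fin m)) L) :
    blockCorr k M = 1 := by
  simp [blockCorr, wick_of_isEmpty]

/-- The value block is block triangular, hence so is its inverse. The Schur complement then inherits
the zero block, and its diagonal blocks are the Schur complements of the two parts. -/
theorem blockCorr_sum (M : Matrix ((α ⊕ β) × Option (Fin m)) ((α ⊕ β) × Option (Fin m)) L)
    (h : ∀ a x b y, M (Sum.inl a, x) (Sum.inr b, y) = 0)
    (h₁ : (blockA (pullback Sum.inl M)).det ≠ 0) (h₂ : (blockA (pullback Sum.inr M)).det ≠ 0) :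
    blockCorr k M = blockCorr k (pullback Sum.inl M) * blockCorr k (pullback Sum.inr M) := by
  have hA : blockA M = Matrix.fromBlocks (blockA (pullback Sum.inl M)) 0
      (Matrix.of fun a b => M (Sum.inr a, none) (Sum.inl b, none))
      (blockA (pullback Sum.inr M)) := by
    ext (a | a) (b | b) <;> simp [blockA, pullback, h]
  have hinv := inv_fromBlocks_zero₁₂_of_isUnit_iff (blockA (pullback Sum.inl M))
      (Matrix.of fun a b => M (Sum.inr a, none) (Sum.inl b, none))
      (blockA (pullback Sum.inr M))
      (by simp [Matrix.isUnit_iff_isUnit_det, isUnit_iff_ne_zero, h₁, h₂])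
  rw [← hA] at hinv
  have h12 : ∀ a b, (blockA M)⁻¹ (Sum.inl a) (Sum.inr b) = 0 := by simp [hinv]
  have h11 : ∀ a b, (blockA M)⁻¹ (Sum.inl a) (Sum.inl b) =
      (blockA (pullback Sum.inl M))⁻¹ a b := by simp [hinv]
  have h22 : ∀ a b, (blockA M)⁻¹ (Sum.inr a) (Sum.inr b) =
      (blockA (pullback Sum.inr M))⁻¹ a b := by simp [hinv]
  have hs : ∀ a b, schurCompl M a b = blockC M a b -
      ∑ p', (∑ p, blockB' M a p * (blockA M)⁻¹ p p') * blockB M p' b := by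
    intro a b
    simp only [schurCompl, Matrix.sub_apply, mul_apply]
  rw [blockCorr, wick_sum, hA, det_fromBlocks_zero₁₂, blockCorr, blockCorr]
  · have e1 : (schurCompl M).submatrix (Prod.map Sum.inl id) (Prod.map Sum.inl id) =
        schurCompl (pullback Sum.inl M) := by
      ext a b
      rw [submatrix_apply, hs]
      simp [h12, h11, blockC, blockB, blockB', pullback, h, schurCompl, mul_apply]
    have e2 : (schurCompl M).submatrix (Prod.map Sum.inr id) (Prod.map Sum.inr id) =
        schurCompl (pullback Sum.inr M) := by
      ext a b
      rw [submatrix_apply, hs]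
      simp [h12, h22, blockC, blockB, blockB', pullback, h, schurCompl, mul_apply]
    rw [e1, e2, mul_pow, mul_inv]
    ring
  · intro a x b y
    rw [hs]
    simp [h12, blockC, blockB, blockB', h]

end BlockCorr

/-! ### The numerator polynomial and the edges in its monomials. -/

section UrsellPolynomial

open Finset

variable {ι R L : Type*} [Fintype ι] [DecidableEq ι] [CommRing R] [Field L] {k m : ℕ}

/-- The restriction of a covariance matrix to a set of points. -/
def restrictPoints (M : Matrix (ι × Option (Fin m)) (ι × Option (Fin m)) R) (W : Finset ι) :
    Matrix (W × Option (Fin m)) (W × Option (Fin m)) R :=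
  pullback (fun p : W => (p : ι)) M

/-- The truncated correlation function of a covariance matrix. -/
noncomputable def ursellCorr (k : ℕ) (M : Matrix (ι × Option (Fin m)) (ι × Option (Fin m)) L) : L :=
  ∑ G : Finpartition (univ : Finset ι), (-1) ^ (#G.parts + 1) * ((#G.parts - 1)! : L) *
    ∏ W ∈ G.parts, blockCorr k (restrictPoints M W)

omit [Fintype ι] in
theorem blockCorr_restrictPoints_union
    (M : Matrix (ι × Option (Fin m)) (ι × Option (Fin m)) L) {s t : Finset ι}
    (hst : Disjoint s t) (h : ∀ p ∈ s, ∀ p' ∈ t, ∀ x y, M (p, x) (p', y) = 0)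
    (hs : (blockA (restrictPoints M s)).det ≠ 0) (ht : (blockA (restrictPoints M t)).det ≠ 0) :
    blockCorr k (restrictPoints M (s ∪ t)) =
      blockCorr k (restrictPoints M s) * blockCorr k (restrictPoints M t) := by
  rw [← blockCorr_pullback_equiv (Equiv.Finset.union s t hst) (restrictPoints M (s ∪ t)),
    blockCorr_sum]
  · rfl
  · intro a x b y
    exact h a a.2 b b.2 x y
  · exact hs
  · exact ht

theorem ursellCorr_eq_zero [CharZero L] (M : Matrix (ι × Option (Fin m)) (ι × Option (Fin m)) L)
    (hdet : ∀ W, (blockA (restrictPoints M W)).det ≠ 0) {S : Finset ι} (hS : S.Nonempty)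
    (hS' : Sᶜ.Nonempty) (h : ∀ p ∈ S, ∀ p' ∉ S, ∀ x y, M (p, x) (p', y) = 0) :
    ursellCorr k M = 0 := by
  refine ursell_eq_zero (fun W => blockCorr k (restrictPoints M W)) (blockCorr_of_isEmpty _) S hS
    hS' fun s t hs ht => blockCorr_restrictPoints_union M ?_ ?_ (hdet s) (hdet t)
  · exact disjoint_compl_right.mono hs ht
  · exact fun p hp p' hp' => h p (hs hp) p' (mem_compl.1 (ht hp'))

/-- The power of the determinant in the denominator of the correlation function. -/
def denExponent (k : ℕ) (W : Finset ι) : ℕ := k + #W * k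

/-- The numerator of the truncated correlation function. -/
def ursellNum (k : ℕ) (M : Matrix (ι × Option (Fin m)) (ι × Option (Fin m)) R) : R :=
  ∑ G : Finpartition (univ : Finset ι), (-1) ^ (#G.parts + 1) * ((#G.parts - 1)! : R) *
    ((∏ W ∈ G.parts, wick k (schurNum (restrictPoints M W))) *
      ∏ W ∈ univ \ G.parts, (blockA (restrictPoints M W)).det ^ denExponent k W)

/-- The denominator of the truncated correlation function. -/
def ursellDen (k : ℕ) (M : Matrix (ι × Option (Fin m)) (ι × Option (Fin m)) R) : R :=
  ∏ W : Finset ι, (blockA (restrictPoints M W)).det ^ denExponent k W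

/-- The denominator runs over all subsets so as to be the same for every partition; the blocks of
`G` cancel their own factors and the remaining ones stay in the numerator. -/
theorem ursellCorr_mul_ursellDen (M : Matrix (ι × Option (Fin m)) (ι × Option (Fin m)) L)
    (hdet : ∀ W, (blockA (restrictPoints M W)).det ≠ 0) :
    ursellCorr k M * ursellDen k M = ursellNum k M := by
  rw [ursellCorr, ursellNum, sum_mul]
  refine sum_congr rfl fun G _ => ?_
  have hW : ∏ W ∈ G.parts, wick k (schurNum (restrictPoints M W)) =
      (∏ W ∈ G.parts, blockCorr k (restrictPoints M W)) *
        ∏ W ∈ G.parts, (blockA (restrictPoints M W)).det ^ denExponent k W := by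
    rw [← prod_mul_distrib]
    refine prod_congr rfl fun W _ => ?_
    rw [blockCorr_eq_div _ (hdet W), Fintype.card_coe, denExponent,
      div_mul_cancel₀ _ (pow_ne_zero _ (hdet W))]
  rw [hW, ursellDen, ← prod_sdiff (subset_univ G.parts)]
  ring

omit [Fintype ι] in
theorem map_det_blockA {R' : Type*} [CommRing R'] (f : R →+* R')
    (M : Matrix (ι × Option (Fin m)) (ι × Option (Fin m)) R) (W : Finset ι) :
    f (blockA (restrictPoints M W)).det = (blockA (restrictPoints (M.map f) W)).det := by
  rw [RingHom.map_det]
  rfl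

theorem map_ursellNum {R' : Type*} [CommRing R'] (f : R →+* R')
    (M : Matrix (ι × Option (Fin m)) (ι × Option (Fin m)) R) :
    f (ursellNum k M) = ursellNum k (M.map f) := by
  simp only [ursellNum, map_sum, map_mul, map_prod, map_pow, map_neg, map_one, map_natCast,
    map_wick, map_schurNum, map_det_blockA]
  rfl

/-- The truncated correlation numerator as a polynomial in the entries of the covariance matrix. -/
noncomputable def ursellPoly (ι : Type*) [Fintype ι] [DecidableEq ι] (k m : ℕ) :
    MvPolynomial ((ι × Option (Fin m)) × (ι × Option (Fin m))) ℂ :=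
  ursellNum k (Matrix.of fun a b => MvPolynomial.X (a, b))

theorem eval_ursellPoly (M : Matrix (ι × Option (Fin m)) (ι × Option (Fin m)) ℂ) :
    MvPolynomial.eval (fun v => M v.1 v.2) (ursellPoly ι k m) = ursellNum k M := by
  rw [ursellPoly, map_ursellNum]
  congr 1
  ext a b
  simp

/-- Setting the variables in `P` to zero keeps the monomials free of them unchanged, and distinct
monomials cannot cancel. -/
theorem MvPolynomial.exists_mem_of_aeval_eq_zero {σ : Type*} (F : MvPolynomial σ ℂ)
    (P : σ → Prop) [DecidablePred P]
    (h : MvPolynomial.aeval (fun v => if P v then 0 else MvPolynomial.X v) F =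
      (0 : MvPolynomial σ ℂ)) {s : σ →₀ ℕ} (hs : s ∈ F.support) : ∃ v ∈ s.support, P v := by
  classical
  by_contra! hcon
  have hmon : ∀ t : σ →₀ ℕ, MvPolynomial.coeff s (MvPolynomial.aeval
      (fun v => if P v then 0 else MvPolynomial.X v : σ → MvPolynomial σ ℂ)
        (MvPolynomial.monomial t (F.coeff t))) = if t = s then F.coeff t else 0 := by
    intro t
    by_cases ht : ∀ v ∈ t.support, ¬ P v
    · have : MvPolynomial.aeval (fun v => if P v then 0 else MvPolynomial.X v :
          σ → MvPolynomial σ ℂ) (MvPolynomial.monomial t (F.coeff t)) =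
          MvPolynomial.monomial t (F.coeff t) := by
        rw [MvPolynomial.aeval_monomial, MvPolynomial.monomial_eq (s := t)]
        congr 1
        exact Finset.prod_congr rfl fun v hv => by
          simp only [if_neg (ht v hv)]
      rw [this, MvPolynomial.coeff_monomial]
    · push Not at ht
      obtain ⟨v, hv, hPv⟩ := ht
      rw [if_neg, MvPolynomial.aeval_monomial, Finsupp.prod, Finset.prod_eq_zero hv, mul_zero,
        MvPolynomial.coeff_zero]
      · rw [if_pos hPv, zero_pow (Finsupp.mem_support_iff.1 hv)]
      · rintro rfl
        exact hcon v hv hPv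
  have h2 := congrArg (MvPolynomial.coeff s) h
  rw [F.as_sum, map_sum, MvPolynomial.coeff_sum, MvPolynomial.coeff_zero] at h2
  simp only [hmon] at h2
  rw [Finset.sum_ite_eq', if_pos hs] at h2
  exact MvPolynomial.mem_support_iff.1 hs h2

/-- Every monomial of the truncated correlation numerator contains an edge from each nontrivial
set of points to its complement. -/
theorem exists_edge_of_mem_support_ursellPoly {S : Finset ι} (hS : S.Nonempty)
    (hS' : Sᶜ.Nonempty) {s : (ι × Option (Fin m)) × (ι × Option (Fin m)) →₀ ℕ}
    (hs : s ∈ (ursellPoly ι k m).support) : ∃ v ∈ s.support, v.1.1 ∈ S ∧ v.2.1 ∉ S := by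
  refine MvPolynomial.exists_mem_of_aeval_eq_zero _ _ ?_ hs
  let N : Matrix (ι × Option (Fin m)) (ι × Option (Fin m))
      (MvPolynomial ((ι × Option (Fin m)) × (ι × Option (Fin m))) ℂ) :=
    Matrix.of fun a b => if a.1 ∈ S ∧ b.1 ∉ S then 0 else MvPolynomial.X (a, b)
  have hN : MvPolynomial.aeval (fun v : (ι × Option (Fin m)) × (ι × Option (Fin m)) =>
      if v.1.1 ∈ S ∧ v.2.1 ∉ S then 0 else MvPolynomial.X v) (ursellPoly ι k m) =
      (ursellNum k N) := by
    rw [ursellPoly, ← AlgHom.coe_toRingHom, map_ursellNum]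
    congr 1
    ext1 a b
    simp [N]
  rw [hN]
  -- The vanishing of the truncated function divides by determinants, so it is applied over the
  -- fraction field.
  let f := algebraMap (MvPolynomial ((ι × Option (Fin m)) × (ι × Option (Fin m))) ℂ)
    (FractionRing (MvPolynomial ((ι × Option (Fin m)) × (ι × Option (Fin m))) ℂ))
  have hf : Function.Injective f := IsFractionRing.injective _ _
  have hdet : ∀ W, (blockA (restrictPoints (N.map f) W)).det ≠ 0 := by
    intro W
    rw [← map_det_blockA, Ne, map_eq_zero_iff f hf]
    intro h0
    -- Specializing to the identity matrix shows that the determinants are nonzero polynomials.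
    have h1 := congrArg (MvPolynomial.eval fun v => if v.1 = v.2 then 1 else 0) h0
    rw [map_det_blockA, map_zero] at h1
    have : blockA (restrictPoints (N.map (MvPolynomial.eval
        fun v : (ι × Option (Fin m)) × (ι × Option (Fin m)) => if v.1 = v.2 then (1 : ℂ) else 0)) W)
        = 1 := by
      ext p p'
      by_cases hp : p = p'
      · subst hp
        simp [blockA, restrictPoints, pullback, N]
      · have hp' : (p : ι) ≠ p' := fun h => hp (Subtype.ext h)
        simp [blockA, restrictPoints, pullback, N, Matrix.one_apply_ne hp, apply_ite]
        exact fun h => absurd h hp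
    rw [this, det_one] at h1
    exact one_ne_zero h1
  apply hf
  rw [map_zero, map_ursellNum, ← ursellCorr_mul_ursellDen _ hdet,
    ursellCorr_eq_zero _ hdet hS hS', zero_mul]
  intro p hp p' hp' x y
  simp [N, hp, hp']

end UrsellPolynomial

/-! ### Moments of complex Gaussians and Wick's formula. -/

section GaussianMoments

open Finset
open scoped ComplexOrder

theorem stdComplexGaussian_eq_withDensity :
    stdComplexGaussian =
      volume.withDensity fun z : ℂ => ENNReal.ofReal (Real.pi⁻¹ * Real.exp (-‖z‖ ^ 2)) := by
  have hv : (1 / 2 : NNReal) ≠ 0 := by norm_num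
  have h1 : (gaussianReal 0 (1 / 2)).prod (gaussianReal 0 (1 / 2)) =
      (volume : Measure (ℝ × ℝ)).withDensity fun x =>
        gaussianPDF 0 (1 / 2) x.1 * gaussianPDF 0 (1 / 2) x.2 := by
    rw [gaussianReal_of_var_ne_zero _ hv, prod_withDensity (measurable_gaussianPDF _ _)
      (measurable_gaussianPDF _ _)]
    rfl
  have h2 : ∀ z : ℂ, gaussianPDF 0 (1 / 2) z.re * gaussianPDF 0 (1 / 2) z.im =
      ENNReal.ofReal (Real.pi⁻¹ * Real.exp (-‖z‖ ^ 2)) := by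
    intro z
    rw [gaussianPDF, gaussianPDF, ← ENNReal.ofReal_mul (gaussianPDFReal_nonneg _ _ _)]
    congr 1
    rw [gaussianPDFReal, gaussianPDFReal, mul_mul_mul_comm, ← Real.exp_add, ← mul_inv,
      Real.mul_self_sqrt (by positivity), ← Complex.normSq_eq_norm_sq, Complex.normSq_apply]
    congr 2
    · push_cast
      ring
    · push_cast
      ring
  have hmap : stdComplexGaussian = ((gaussianReal 0 (1 / 2)).prod (gaussianReal 0 (1 / 2))).map
      Complex.measurableEquivRealProd.symm := rfl
  rw [hmap, h1]
  ext s hs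
  rw [Measure.map_apply Complex.measurableEquivRealProd.symm.measurable hs,
    withDensity_apply _ (Complex.measurableEquivRealProd.symm.measurable hs),
    withDensity_apply _ hs,
    ← Complex.volume_preserving_equiv_real_prod.symm.setLIntegral_comp_preimage_emb
      Complex.measurableEquivRealProd.symm.measurableEmbedding]
  refine lintegral_congr fun x => ?_
  rw [← h2]
  rfl

instance : IsProbabilityMeasure stdComplexGaussian :=
  Measure.isProbabilityMeasure_map Complex.measurableEquivRealProd.symm.measurable.aemeasurable

theorem integral_norm_pow_mul_exp_neg (a : ℕ) :
    ∫ z : ℂ, ‖z‖ ^ (2 * a) * Real.exp (-‖z‖ ^ 2) = Real.pi * (a ! : ℝ) := by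
  have h := Complex.integral_rpow_mul_exp_neg_rpow (p := 2) (q := (2 * a : ℕ)) (by norm_num)
    (by push_cast; linarith [(Nat.cast_nonneg a : (0 : ℝ) ≤ a)])
  simp only [Real.rpow_natCast, Real.rpow_ofNat] at h
  rw [h, ← Real.Gamma_nat_eq_factorial]
  push_cast
  rw [show (2 * (a : ℝ) + 2) / 2 = a + 1 by ring]
  ring

theorem integrable_norm_pow_mul_exp_neg (a : ℕ) :
    Integrable fun z : ℂ => ‖z‖ ^ a * Real.exp (-‖z‖ ^ 2) := by
  have h := Complex.integral_rpow_mul_exp_neg_rpow (p := 2) (q := (a : ℝ)) (by norm_num)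
    (by linarith [(Nat.cast_nonneg a : (0 : ℝ) ≤ a)])
  simp only [Real.rpow_natCast, Real.rpow_ofNat] at h
  refine not_imp_comm.1 integral_undef ?_
  rw [h]
  have := Real.Gamma_pos_of_pos (s := ((a : ℝ) + 2) / 2) (by positivity)
  positivity

theorem integral_stdComplexGaussian (f : ℂ → ℂ) :
    ∫ z, f z ∂stdComplexGaussian =
      ∫ z, ((Real.pi⁻¹ * Real.exp (-‖z‖ ^ 2) : ℝ) : ℂ) * f z := by
  rw [stdComplexGaussian_eq_withDensity, integral_withDensity_eq_integral_toReal_smul (by fun_prop)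
    (by simp)]
  refine integral_congr_ae (ae_of_all _ fun z => ?_)
  simp only
  rw [ENNReal.toReal_ofReal (by positivity), Complex.real_smul]

theorem integrable_monomial_stdComplexGaussian (a b : ℕ) :
    Integrable (fun z : ℂ => z ^ a * star z ^ b) stdComplexGaussian := by
  rw [stdComplexGaussian_eq_withDensity, integrable_withDensity_iff_integrable_smul' (by fun_prop)
    (by simp)]
  refine ((integrable_norm_pow_mul_exp_neg (a + b)).const_mul Real.pi⁻¹).mono' ?_
    (ae_of_all _ fun z => ?_)
  · refine Measurable.aestronglyMeasurable ?_
    fun_prop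
  · rw [ENNReal.toReal_ofReal (by positivity), norm_smul, Real.norm_of_nonneg (by positivity),
      norm_mul, norm_pow, norm_pow, norm_star, pow_add]
    apply le_of_eq
    ring

theorem integral_monomial_stdComplexGaussian (a b : ℕ) :
    ∫ z : ℂ, z ^ a * star z ^ b ∂stdComplexGaussian = if a = b then (a ! : ℂ) else 0 := by
  rw [integral_stdComplexGaussian]
  split_ifs with hab
  · subst hab
    have : ∀ z : ℂ, ((Real.pi⁻¹ * Real.exp (-‖z‖ ^ 2) : ℝ) : ℂ) * (z ^ a * star z ^ a) =
        ((Real.pi⁻¹ * (‖z‖ ^ (2 * a) * Real.exp (-‖z‖ ^ 2)) : ℝ) : ℂ) := by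
      intro z
      rw [← mul_pow, Complex.star_def, Complex.mul_conj, Complex.normSq_eq_norm_sq, pow_mul]
      push_cast
      ring
    simp_rw [this]
    rw [integral_complex_ofReal, integral_const_mul, integral_norm_pow_mul_exp_neg,
      inv_mul_cancel_left₀ Real.pi_ne_zero, Complex.ofReal_natCast]
  · set I := ∫ z : ℂ, ((Real.pi⁻¹ * Real.exp (-‖z‖ ^ 2) : ℝ) : ℂ) * (z ^ a * star z ^ b) with hI
    -- Rotation invariance of the Gaussian weight; the angle $\pi/(a-b)$ used below gives `I = -I`.
    have hrot : ∀ θ : ℝ, I = Complex.exp (((a : ℂ) - b) * θ * Complex.I) * I := by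
      intro θ
      have h1 := (rotation (Circle.exp θ)).measurePreserving.integral_comp'
        (f := (rotation (Circle.exp θ)).toMeasurableEquiv)
        fun z : ℂ => ((Real.pi⁻¹ * Real.exp (-‖z‖ ^ 2) : ℝ) : ℂ) * (z ^ a * star z ^ b)
      rw [← hI] at h1
      refine h1.symm.trans ?_
      rw [hI, ← integral_const_mul]
      refine integral_congr_ae (ae_of_all _ fun z => ?_)
      simp only [LinearIsometryEquiv.coe_toMeasurableEquiv, LinearIsometryEquiv.norm_map]
      simp only [rotation_apply, star_mul, mul_pow, Circle.coe_exp, Complex.star_def, ← Complex.exp_conj]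
      have : Complex.exp (((a : ℂ) - b) * θ * Complex.I) = Complex.exp (θ * Complex.I) ^ a *
          Complex.exp ((starRingEnd ℂ) (θ * Complex.I)) ^ b := by
        rw [← Complex.exp_nat_mul, ← Complex.exp_nat_mul, ← Complex.exp_add]
        congr 1
        simp
        ring
      rw [this]
      ring
    have hab' : ((a : ℂ) - b) ≠ 0 := sub_ne_zero.2 (by exact_mod_cast hab)
    have h2 := hrot (Real.pi / ((a : ℝ) - b))
    have h3 : ((a : ℂ) - b) * ((Real.pi / ((a : ℝ) - b) : ℝ) : ℂ) * Complex.I =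
        Real.pi * Complex.I := by
      push_cast
      field_simp
    rw [h3, Complex.exp_pi_mul_I] at h2
    linear_combination (1 / 2 : ℂ) * h2

/-- If one such permutation exists, they form a coset of the stabilizer of `f`; otherwise some
fibres of `f` and `g` differ in size. This turns the product of one-variable moments into a sum over
pairings. -/
theorem card_perm_comp_eq {I κ : Type*} [Fintype I] [DecidableEq I] [Fintype κ] [DecidableEq κ]
    (f g : I → κ) :
    Fintype.card {σ : Equiv.Perm I // f ∘ σ = g} =
      ∏ c, if Fintype.card {i // f i = c} = Fintype.card {i // g i = c}
        then (Fintype.card {i // f i = c})! else 0 := by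
  by_cases h : ∃ σ₀ : Equiv.Perm I, f ∘ σ₀ = g
  · obtain ⟨σ₀, rfl⟩ := h
    have hc : ∀ c, Fintype.card {i // f i = c} = Fintype.card {i // (f ∘ σ₀) i = c} := fun c =>
      (Fintype.card_congr (σ₀.subtypeEquiv fun i => Iff.rfl)).symm
    simp only [← hc, if_true]
    rw [← DomMulAct.stabilizer_card]
    refine Fintype.card_congr ((Equiv.mulRight σ₀⁻¹).subtypeEquiv fun σ => ?_)
    constructor
    · intro h
      ext i
      simpa using congrFun h (σ₀⁻¹ i)
    · intro h
      ext i
      simpa using congrFun h (σ₀ i)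
  · have : IsEmpty {σ : Equiv.Perm I // f ∘ σ = g} := ⟨fun σ => h ⟨σ.1, σ.2⟩⟩
    rw [Fintype.card_eq_zero]
    by_contra hne
    have hc : ∀ c, Fintype.card {i // f i = c} = Fintype.card {i // g i = c} := by
      intro c
      by_contra hcc
      exact hne (Finset.prod_eq_zero (mem_univ c) (if_neg hcc)).symm
    refine h ⟨(Equiv.sigmaFiberEquiv g).symm.trans ((Equiv.sigmaCongrRight fun c =>
      (Fintype.equivOfCardEq (hc c)).symm).trans (Equiv.sigmaFiberEquiv f)), ?_⟩
    ext i
    exact ((Fintype.equivOfCardEq (hc (g i))).symm ⟨i, rfl⟩).2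

theorem prod_comp_eq_prod_pow_card {I κ : Type*} [Fintype I] [Fintype κ] [DecidableEq κ]
    (f : I → κ) (w : κ → ℂ) : ∏ i, w (f i) = ∏ c, w c ^ Fintype.card {i // f i = c} := by
  rw [← Fintype.prod_fiberwise f]
  refine prod_congr rfl fun c _ => ?_
  rw [prod_congr rfl fun (i : {i // f i = c}) _ => congrArg w i.2, prod_const, card_univ]

theorem integrable_prod_stdComplexGaussian {I κ : Type*} [Fintype I] [Fintype κ] [DecidableEq κ]
    (f g : I → κ) : Integrable (fun w : κ → ℂ => (∏ i, w (f i)) * ∏ i, star (w (g i)))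
      (Measure.pi fun _ : κ => stdComplexGaussian) := by
  have : ∀ w : κ → ℂ, (∏ i, w (f i)) * ∏ i, star (w (g i)) =
      ∏ c, (w c ^ Fintype.card {i // f i = c} * star (w c) ^ Fintype.card {i // g i = c}) := by
    intro w
    rw [prod_comp_eq_prod_pow_card f, prod_comp_eq_prod_pow_card g fun c => star (w c),
      prod_mul_distrib]
  simp_rw [this]
  exact Integrable.fintype_prod fun c => integrable_monomial_stdComplexGaussian _ _

theorem integral_prod_stdComplexGaussian {I κ : Type*} [Fintype I] [DecidableEq I] [Fintype κ]
    [DecidableEq κ] (f g : I → κ) :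
    ∫ w : κ → ℂ, (∏ i, w (f i)) * ∏ i, star (w (g i)) ∂(Measure.pi fun _ => stdComplexGaussian) =
      ∑ σ : Equiv.Perm I, ∏ i, if f (σ i) = g i then 1 else 0 := by
  have : ∀ w : κ → ℂ, (∏ i, w (f i)) * ∏ i, star (w (g i)) =
      ∏ c, (w c ^ Fintype.card {i // f i = c} * star (w c) ^ Fintype.card {i // g i = c}) := by
    intro w
    rw [prod_comp_eq_prod_pow_card f, prod_comp_eq_prod_pow_card g fun c => star (w c),
      prod_mul_distrib]
  simp_rw [this]
  rw [integral_fintype_prod_eq_prod (𝕜 := ℂ) (fun c (x : ℂ) =>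
    x ^ Fintype.card {i // f i = c} * star x ^ Fintype.card {i // g i = c})]
  simp_rw [integral_monomial_stdComplexGaussian]
  have h2 := congrArg (Nat.cast : ℕ → ℂ) (card_perm_comp_eq f g)
  push_cast at h2
  rw [← h2, Fintype.card_subtype, card_eq_sum_ones, sum_filter]
  push_cast
  refine sum_congr rfl fun σ _ => ?_
  rw [Fintype.prod_boole]
  simp only [funext_iff, Function.comp_apply]

/-- The Wick formula. -/
theorem integral_prod_complexGaussian {I κ : Type*} [Fintype I] [DecidableEq I] [Fintype κ]
    [DecidableEq κ] {S : Matrix κ κ ℂ} (hS : S.PosSemidef) (a b : I → κ) :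
    Integrable (fun ξ : κ → ℂ => (∏ i, ξ (a i)) * ∏ i, star (ξ (b i))) (complexGaussian S) ∧
    ∫ ξ : κ → ℂ, (∏ i, ξ (a i)) * ∏ i, star (ξ (b i)) ∂complexGaussian S =
      (Matrix.of fun i j => S (a i) (b j)).permanent := by
  set X := CFC.sqrt S with hX
  have hXX : X * X = S := CFC.sqrt_mul_sqrt_self S hS.nonneg
  have hXs : ∀ c d, star (X c d) = X d c := by
    have h0 : X.IsHermitian := (Matrix.nonneg_iff_posSemidef.1 (CFC.sqrt_nonneg S)).1
    exact fun c d => h0.apply d c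
  have hmeas : Measurable fun w : κ → ℂ => X *ᵥ w := by
    refine (Continuous.matrix_mulVec continuous_const continuous_id).measurable
  have hmeas' : Measurable fun ξ : κ → ℂ => (∏ i, ξ (a i)) * ∏ i, star (ξ (b i)) := by
    fun_prop
  have hexp : ∀ w : κ → ℂ, (∏ i, (X *ᵥ w) (a i)) * ∏ i, star ((X *ᵥ w) (b i)) =
      ∑ f : I → κ, ∑ g : I → κ, ((∏ i, X (a i) (f i)) * ∏ i, X (g i) (b i)) *
        ((∏ i, w (f i)) * ∏ i, star (w (g i))) := by
    intro w
    simp only [mulVec, dotProduct, star_sum, star_mul']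
    rw [Fintype.prod_sum, Fintype.prod_sum, sum_mul_sum]
    refine sum_congr rfl fun f _ => sum_congr rfl fun g _ => ?_
    rw [prod_mul_distrib, prod_mul_distrib]
    simp only [hXs]
    ring
  rw [complexGaussian, ← hX]
  rw [integrable_map_measure hmeas'.aestronglyMeasurable hmeas.aemeasurable,
    integral_map hmeas.aemeasurable hmeas'.aestronglyMeasurable]
  simp only [Function.comp_def, hexp]
  have hint : ∀ f g : I → κ, Integrable (fun w : κ → ℂ =>
      ((∏ i, X (a i) (f i)) * ∏ i, X (g i) (b i)) * ((∏ i, w (f i)) * ∏ i, star (w (g i))))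
      (Measure.pi fun _ : κ => stdComplexGaussian) := fun f g =>
    (integrable_prod_stdComplexGaussian f g).const_mul _
  refine ⟨integrable_finsetSum _ fun f _ => integrable_finsetSum _ fun g _ => hint f g, ?_⟩
  rw [integral_finsetSum _ fun f _ => integrable_finsetSum _ fun g _ => hint f g]
  simp_rw [integral_finsetSum _ fun g _ => hint _ g, integral_const_mul,
    integral_prod_stdComplexGaussian, permanent, mul_sum]
  rw [sum_comm' (t' := univ) (s' := fun _ => univ) (by simp)]
  rw [sum_congr rfl fun g _ => sum_comm, sum_comm]
  refine sum_congr rfl fun σ _ => ?_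
  have hterm : ∀ f g : I → κ, ((∏ i, X (a i) (f i)) * ∏ i, X (g i) (b i)) *
      (∏ i, if f (σ i) = g i then (1 : ℂ) else 0) =
      ∏ i, (X (a (σ i)) (f (σ i)) * X (g i) (b i) * if f (σ i) = g i then (1 : ℂ) else 0) := by
    intro f g
    rw [prod_mul_distrib, prod_mul_distrib, Equiv.prod_comp σ fun i => X (a i) (f i)]
  simp_rw [hterm]
  -- Reindexing `f` by `σ` collapses its sum to `f ∘ σ = g`; the sum over `g` then assembles the
  -- entries of $X^2=S$.
  have hf : ∀ g : I → κ, ∑ f : I → κ, ∏ i, (X (a (σ i)) (f (σ i)) * X (g i) (b i) *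
      if f (σ i) = g i then (1 : ℂ) else 0) = ∏ i, (X (a (σ i)) (g i) * X (g i) (b i)) := by
    intro g
    rw [← (Equiv.arrowCongr σ (Equiv.refl κ)).sum_comp]
    simp only [Equiv.arrowCongr_apply, Equiv.coe_refl, Function.comp_apply, id,
      Equiv.symm_apply_apply]
    rw [← Fintype.prod_sum (fun i c => X (a (σ i)) c * X (g i) (b i) *
      if c = g i then (1 : ℂ) else 0)]
    simp
  simp_rw [hf]
  rw [← Fintype.prod_sum (fun i c => X (a (σ i)) c * X c (b i))]
  refine prod_congr rfl fun i _ => ?_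
  rw [of_apply, ← hXX, mul_apply]

/-- The Gaussian expectation of the product of determinants. -/
theorem integral_prod_det_complexGaussian {ι : Type*} [Fintype ι] [DecidableEq ι] {k m : ℕ}
    {Λ : Matrix (ι × Fin m) (ι × Fin m) ℂ} (hΛ : Λ.PosSemidef) :
    ∫ ξ : Fin k × (ι × Fin m) → ℂ,
      ∏ p : ι, (Matrix.of fun j j' : Fin k => ∑ q : Fin m, ξ (j, p, q) * star (ξ (j', p, q))).det
      ∂complexGaussian ((1 : Matrix (Fin k) (Fin k) ℂ) ⊗ₖ Λ) = wick k Λ := by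
  have hS : ((1 : Matrix (Fin k) (Fin k) ℂ) ⊗ₖ Λ).PosSemidef := PosSemidef.one.kronecker hΛ
  have hexp : ∀ ξ : Fin k × (ι × Fin m) → ℂ,
      ∏ p : ι, (Matrix.of fun j j' : Fin k => ∑ q : Fin m, ξ (j, p, q) * star (ξ (j', p, q))).det =
      ∑ ω : ι → Equiv.Perm (Fin k) × (Fin k → Fin m),
        (∏ p, ((Equiv.Perm.sign (ω p).1 : ℤ) : ℂ)) *
          ((∏ i : ι × Fin k, ξ ((ω i.1).1 i.2, i.1, (ω i.1).2 i.2)) *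
            ∏ i : ι × Fin k, star (ξ (i.2, i.1, (ω i.1).2 i.2))) := by
    intro ξ
    have hdet : ∀ p : ι, (Matrix.of fun j j' : Fin k =>
        ∑ q : Fin m, ξ (j, p, q) * star (ξ (j', p, q))).det =
        ∑ x : Equiv.Perm (Fin k) × (Fin k → Fin m), ((Equiv.Perm.sign x.1 : ℤ) : ℂ) *
          ∏ j, (ξ (x.1 j, p, x.2 j) * star (ξ (j, p, x.2 j))) := by
      intro p
      rw [det_apply', Fintype.sum_prod_type]
      refine sum_congr rfl fun σ _ => ?_
      simp only [of_apply]
      rw [Fintype.prod_sum, mul_sum]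
    simp_rw [hdet]
    rw [Fintype.prod_sum]
    refine sum_congr rfl fun ω _ => ?_
    rw [prod_mul_distrib, Fintype.prod_prod_type, Fintype.prod_prod_type]
    simp only [prod_mul_distrib]
  simp_rw [hexp]
  have hw := fun ω : ι → Equiv.Perm (Fin k) × (Fin k → Fin m) =>
    integral_prod_complexGaussian hS (fun i : ι × Fin k => ((ω i.1).1 i.2, i.1, (ω i.1).2 i.2))
      (fun i : ι × Fin k => (i.2, i.1, (ω i.1).2 i.2))
  rw [integral_finsetSum _ fun ω _ => (hw ω).1.const_mul _, wick]
  refine sum_congr rfl fun ω _ => ?_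
  rw [integral_const_mul, (hw ω).2]
  congr 2
  ext i j
  simp [choiceMatrix, kroneckerMap_apply, Matrix.one_apply]

end GaussianMoments

/-! ### A lower bound for the exponential kernel at separated points. -/

section FockKernel

open Finset

theorem sum_star_mul_pow_card {ι κ J : Type*} [Fintype ι] [Fintype κ] [Fintype J] [DecidableEq J]
    (b : ι → ℂ) (v : ι → κ → ℂ) :
    ∑ p, ∑ p', b p * star (b p') * (∑ c, v p c * star (v p' c)) ^ Fintype.card J =
      ((∑ s : J → κ, ‖∑ p, b p * ∏ i, v p (s i)‖ ^ 2 : ℝ) : ℂ) := by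
  have h1 : ∀ s : J → κ, ((‖∑ p, b p * ∏ i, v p (s i)‖ ^ 2 : ℝ) : ℂ) =
      ∑ p, ∑ p', b p * star (b p') * ∏ i, (v p (s i) * star (v p' (s i))) := by
    intro s
    rw [← Complex.normSq_eq_norm_sq, ← Complex.mul_conj, ← Complex.star_def, star_sum, sum_mul_sum]
    refine sum_congr rfl fun p _ => sum_congr rfl fun p' _ => ?_
    rw [prod_mul_distrib, star_mul', star_prod]
    ring
  have h2 : ∀ p p', (∑ c, v p c * star (v p' c)) ^ Fintype.card J =
      ∑ s : J → κ, ∏ i, (v p (s i) * star (v p' (s i))) := by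
    intro p p'
    rw [← Fintype.prod_sum (fun (_ : J) c => v p c * star (v p' c)), prod_const, card_univ]
  rw [Complex.ofReal_sum]
  simp_rw [h1]
  symm
  rw [sum_comm]
  refine sum_congr rfl fun p _ => ?_
  rw [sum_comm]
  refine sum_congr rfl fun p' _ => ?_
  rw [h2, mul_sum]

/-- A product of linear forms is a functional on the tensor power whose norm is the product of the
norms; apply Cauchy–Schwarz. -/
theorem norm_sq_le_mul_sum_norm_sq {ι κ J : Type*} [Fintype ι] [Fintype κ] [Fintype J] [DecidableEq J]
    (b : ι → ℂ) (v : ι → κ → ℂ) (l : J → κ → ℂ) :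
    ‖∑ p, b p * ∏ i, ∑ c, l i c * v p c‖ ^ 2 ≤
      (∏ i, ∑ c, ‖l i c‖ ^ 2) * ∑ s : J → κ, ‖∑ p, b p * ∏ i, v p (s i)‖ ^ 2 := by
  have h1 : ∑ p, b p * ∏ i, ∑ c, l i c * v p c =
      ∑ s : J → κ, (∏ i, l i (s i)) * ∑ p, b p * ∏ i, v p (s i) := by
    simp_rw [mul_sum]
    rw [sum_comm]
    refine sum_congr rfl fun p _ => ?_
    rw [Fintype.prod_sum, mul_sum]
    refine sum_congr rfl fun s _ => ?_
    rw [prod_mul_distrib]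
    ring
  have h2 : ∏ i, ∑ c, ‖l i c‖ ^ 2 = ∑ s : J → κ, ‖∏ i, l i (s i)‖ ^ 2 := by
    rw [Fintype.prod_sum]
    refine sum_congr rfl fun s _ => ?_
    rw [norm_prod, prod_pow]
  rw [h1, h2]
  refine le_trans ?_ (sum_mul_sq_le_sq_mul_sq _ _ _)
  refine pow_le_pow_left₀ (norm_nonneg _) ((norm_sum_le _ _).trans_eq ?_) 2
  simp_rw [norm_mul]

variable {m : ℕ} {ι : Type*} [Fintype ι]

theorem sum_mul_star_eq_inner (z w : EuclideanSpace ℂ (Fin m)) :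
    ∑ q, z q * star (w q) = inner ℂ w z := by
  simp [PiLp.inner_apply, RCLike.inner_apply]

/-- The Hermitian form of the kernel `exp ⟨z, w⟩` at the points `y p`. -/
noncomputable def expForm (b : ι → ℂ) (y : ι → EuclideanSpace ℂ (Fin m)) : ℂ :=
  ∑ p, ∑ p', b p * star (b p') * Complex.exp (inner ℂ (y p') (y p))

/-- The squared norm of the homogeneous component of degree `j`. -/
noncomputable def degreeForm (b : ι → ℂ) (y : ι → EuclideanSpace ℂ (Fin m)) (j : ℕ) : ℝ :=
  ∑ s : Fin j → Fin m, ‖∑ p, b p * ∏ i, y p (s i)‖ ^ 2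

theorem degreeForm_nonneg (b : ι → ℂ) (y : ι → EuclideanSpace ℂ (Fin m)) (j : ℕ) :
    0 ≤ degreeForm b y j :=
  sum_nonneg fun _ _ => sq_nonneg _

theorem sum_inner_pow_eq_degreeForm (b : ι → ℂ) (y : ι → EuclideanSpace ℂ (Fin m)) (j : ℕ) :
    ∑ p, ∑ p', b p * star (b p') * inner ℂ (y p') (y p) ^ j = (degreeForm b y j : ℂ) := by
  have := sum_star_mul_pow_card (J := Fin j) b fun p => ⇑(y p)
  simp only [sum_mul_star_eq_inner, Fintype.card_fin] at this
  exact this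

theorem hasSum_degreeForm (b : ι → ℂ) (y : ι → EuclideanSpace ℂ (Fin m)) :
    HasSum (fun j => degreeForm b y j / (j ! : ℝ)) (expForm b y).re ∧ (expForm b y).im = 0 := by
  have h : HasSum (fun j => ((degreeForm b y j / (j ! : ℝ) : ℝ) : ℂ)) (expForm b y) := by
    have h1 : ∀ j, ((degreeForm b y j / (j ! : ℝ) : ℝ) : ℂ) =
        ∑ p, ∑ p', b p * star (b p') * (inner ℂ (y p') (y p) ^ j / (j ! : ℂ)) := by
      intro j
      push_cast
      rw [← sum_inner_pow_eq_degreeForm, sum_div]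
      refine sum_congr rfl fun p _ => ?_
      rw [sum_div]
      exact sum_congr rfl fun p' _ => by ring
    simp_rw [h1, expForm]
    refine hasSum_sum fun p _ => hasSum_sum fun p' _ => HasSum.mul_left _ ?_
    rw [Complex.exp_eq_exp_ℂ]
    exact NormedSpace.expSeries_div_hasSum_exp _
  rw [Complex.hasSum_iff] at h
  simp only [Complex.ofReal_re, Complex.ofReal_im] at h
  exact ⟨h.1, h.2.unique hasSum_zero⟩

theorem expForm_re_nonneg (b : ι → ℂ) (y : ι → EuclideanSpace ℂ (Fin m)) :
    0 ≤ (expForm b y).re :=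
  (hasSum_degreeForm b y).1.nonneg fun j => div_nonneg (degreeForm_nonneg b y j) (by positivity)

/-- The kernel `(1 + ⟨z, w⟩) ^ N` is dominated by `N! * exp ⟨z, w⟩`. -/
theorem sum_one_add_inner_pow_le (b : ι → ℂ) (y : ι → EuclideanSpace ℂ (Fin m)) (N : ℕ) :
    (∑ p, ∑ p', b p * star (b p') * (1 + inner ℂ (y p') (y p)) ^ N).re ≤
      (N ! : ℝ) * (expForm b y).re := by
  have h1 : ∑ p, ∑ p', b p * star (b p') * (1 + inner ℂ (y p') (y p)) ^ N =
      ((∑ j ∈ range (N + 1), (N.choose j : ℝ) * degreeForm b y j : ℝ) : ℂ) := by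
    push_cast
    simp_rw [← sum_inner_pow_eq_degreeForm, mul_sum]
    rw [sum_comm' (t' := univ) (s' := fun _ => range (N + 1)) (by simp)]
    refine sum_congr rfl fun p _ => ?_
    rw [sum_comm' (t' := univ) (s' := fun _ => range (N + 1)) (by simp)]
    refine sum_congr rfl fun p' _ => ?_
    rw [add_comm, add_pow, mul_sum]
    refine sum_congr rfl fun j _ => ?_
    rw [one_pow]
    ring
  rw [h1, Complex.ofReal_re]
  have h2 := sum_le_hasSum (range (N + 1)) (fun j _ =>
    div_nonneg (degreeForm_nonneg b y j) (by positivity)) (hasSum_degreeForm b y).1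
  refine le_trans ?_ (mul_le_mul_of_nonneg_left h2 (by positivity))
  rw [mul_sum]
  refine sum_le_sum fun j hj => ?_
  rw [mul_div_assoc', mul_comm (N ! : ℝ), mul_comm (N.choose j : ℝ), mul_div_assoc]
  refine mul_le_mul_of_nonneg_left ?_ (degreeForm_nonneg b y j)
  rw [le_div_iff₀ (by positivity)]
  -- The comparison needed is $\binom Nj\le N!/j!$.
  have := Nat.choose_mul_factorial_mul_factorial (Nat.lt_succ_iff.1 (mem_range.1 hj))
  rw [← this]
  push_cast
  exact le_mul_of_one_le_right (by positivity) (by exact_mod_cast Nat.factorial_pos _)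

/-- A lower bound for the form of the exponential kernel at separated points, one of which is the
origin. -/
theorem norm_sq_le_expForm [DecidableEq ι] {c : ℝ} (hc : 0 < c) (b : ι → ℂ)
    (y : ι → EuclideanSpace ℂ (Fin m)) (p₀ : ι) (h0 : y p₀ = 0) (hy : ∀ p, p ≠ p₀ → c ≤ ‖y p‖) :
    ‖b p₀‖ ^ 2 ≤ (1 + 1 / c ^ 2) ^ (Fintype.card ι - 1) * ((Fintype.card ι - 1)! : ℝ) *
      (expForm b y).re := by
  -- With `v p = (1, y p)`, the form `l i` is the affine function $1-\langle y_i,y\rangle/|y_i|^2$,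
  -- equal to 1 at the origin and 0 at `y i`. The product of these isolates `b p₀`.
  let v : ι → Option (Fin m) → ℂ := fun p o => o.elim 1 fun q => y p q
  let l : {p // p ≠ p₀} → Option (Fin m) → ℂ := fun i o =>
    o.elim 1 fun q => - star (y i q) / (‖y i‖ ^ 2 : ℝ)
  have hcard : Fintype.card {p // p ≠ p₀} = Fintype.card ι - 1 := by
    simp [Fintype.card_subtype_compl]
  have hpos : ∀ i : {p // p ≠ p₀}, 0 < ‖y i‖ := fun i => hc.trans_le (hy i i.2)
  have hinner : ∀ p p', ∑ o, v p o * star (v p' o) = 1 + inner ℂ (y p') (y p) := by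
    intro p p'
    rw [Fintype.sum_option, ← sum_mul_star_eq_inner]
    simp [v]
  have hlv : ∀ i p, ∑ o, l i o * v p o = 1 - inner ℂ (y i) (y p) / (‖y i‖ ^ 2 : ℝ) := by
    intro i p
    rw [Fintype.sum_option, ← sum_mul_star_eq_inner, sum_div, sub_eq_add_neg, ← sum_neg_distrib]
    simp only [l, v, Option.elim, mul_one]
    congr 1
    exact sum_congr rfl fun q _ => by ring
  have hsum : ∑ p, b p * ∏ i, ∑ o, l i o * v p o = b p₀ := by
    rw [sum_eq_single p₀]
    · simp [hlv, h0]
    · intro p _ hp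
      rw [prod_eq_zero (mem_univ ⟨p, hp⟩), mul_zero]
      have hne : ((‖y p‖ : ℝ) : ℂ) ≠ 0 := by exact_mod_cast (hpos ⟨p, hp⟩).ne'
      rw [hlv, inner_self_eq_norm_sq_to_K]
      push_cast
      simp [hne]
    · simp
  have hl : ∀ i, ∑ o, ‖l i o‖ ^ 2 ≤ 1 + 1 / c ^ 2 := by
    intro i
    rw [Fintype.sum_option]
    have : ∑ q, ‖l i (some q)‖ ^ 2 = 1 / ‖y i‖ ^ 2 := by
      have h3 : ∀ q, ‖l i (some q)‖ ^ 2 = ‖y i q‖ ^ 2 * (1 / ‖y i‖ ^ 4) := by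
        intro q
        simp only [l, Option.elim, norm_div, norm_neg, norm_star, Complex.norm_real, norm_pow,
          norm_norm]
        rw [div_pow, ← pow_mul]
        ring
      simp_rw [h3]
      rw [← sum_mul, ← EuclideanSpace.norm_sq_eq]
      have := (hpos i).ne'
      field_simp
    rw [this]
    simp only [l, Option.elim, norm_one, one_pow]
    gcongr
    exact hy i i.2
  have key := norm_sq_le_mul_sum_norm_sq b v l
  have hre := sum_star_mul_pow_card (J := {p // p ≠ p₀}) b v
  simp only [hinner] at hre
  have hle := sum_one_add_inner_pow_le b y (Fintype.card {p // p ≠ p₀})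
  rw [hre, Complex.ofReal_re] at hle
  rw [hsum] at key
  refine key.trans ?_
  rw [mul_assoc]
  refine mul_le_mul ?_ (hle.trans_eq (by rw [hcard])) (sum_nonneg fun _ _ => sq_nonneg _)
    (by positivity)
  calc ∏ i, ∑ o, ‖l i o‖ ^ 2 ≤ ∏ _i : {p // p ≠ p₀}, (1 + 1 / c ^ 2) :=
        prod_le_prod (fun _ _ => sum_nonneg fun _ _ => sq_nonneg _) fun i _ => hl i
    _ = _ := by rw [prod_const, card_univ, hcard]

end FockKernel

/-! ### Positivity for derivatives, as a limit of difference quotients. -/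

section FockDerivative

open Finset Topology

theorem tendsto_exp_sub_one_div (a : ℂ) :
    Tendsto (fun t : ℝ => (Complex.exp (t * a) - 1) / t) (𝓝[≠] 0) (𝓝 a) := by
  have h : HasDerivAt (fun t : ℝ => Complex.exp (t * a)) a 0 := by
    have h1 : HasDerivAt (fun t : ℝ => (t : ℂ) * a) a 0 := by
      simpa using (Complex.ofRealCLM.hasDerivAt (x := 0)).mul_const a
    simpa using h1.cexp
  have h2 := hasDerivAt_iff_tendsto_slope_zero.1 h
  refine h2.congr fun t => ?_
  simp [div_eq_inv_mul]

theorem tendsto_exp_sq_sub_one_div (a : ℂ) :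
    Tendsto (fun t : ℝ => (Complex.exp (t ^ 2 * a) - 1) / t ^ 2) (𝓝[≠] 0) (𝓝 a) := by
  have h : Tendsto (fun t : ℝ => t ^ 2) (𝓝[≠] 0) (𝓝[≠] 0) := by
    refine tendsto_nhdsWithin_iff.2 ⟨?_, ?_⟩
    · have : Tendsto (fun t : ℝ => t ^ 2) (𝓝 0) (𝓝 (0 ^ 2)) := (continuous_pow 2).tendsto 0
      rw [zero_pow two_ne_zero] at this
      exact this.mono_left nhdsWithin_le_nhds
    · filter_upwards [self_mem_nhdsWithin] with t ht
      exact pow_ne_zero 2 ht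
  refine ((tendsto_exp_sub_one_div a).comp h).congr fun t => ?_
  simp

variable {m : ℕ} {ι : Type*} [Fintype ι]

/-- The Hermitian form of the exponential kernel on combinations of values and derivatives is
nonnegative. -/
theorem exp_deriv_form_nonneg (α : ι → ℂ) (γ z : ι → EuclideanSpace ℂ (Fin m)) :
    0 ≤ (∑ p, ∑ p', Complex.exp (inner ℂ (z p') (z p)) *
      ((α p + inner ℂ (z p') (γ p)) * (star (α p') + inner ℂ (γ p') (z p)) +
        inner ℂ (γ p') (γ p))).re := by
  let u : ι → ι → ℝ → ℂ := fun p p' t => (Complex.exp (t * inner ℂ (z p') (γ p)) - 1) / t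
  let v : ι → ι → ℝ → ℂ := fun p p' t => (Complex.exp (t * inner ℂ (γ p') (z p)) - 1) / t
  let d : ι → ι → ℝ → ℂ := fun p p' t => (Complex.exp (t ^ 2 * inner ℂ (γ p') (γ p)) - 1) / t ^ 2
  have hexp : ∀ t : ℝ, t ≠ 0 →
      -- The weights represent $\alpha_p\delta_{z_p}+(\delta_{z_p+t\gamma_p}-\delta_{z_p})/t$: a
      -- value plus a difference quotient.
      expForm (Sum.elim (fun p => α p - 1 / t) (fun _ => 1 / (t : ℂ)))
        (Sum.elim z fun p => z p + (t : ℂ) • γ p) =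
      ∑ p, ∑ p', Complex.exp (inner ℂ (z p') (z p)) *
        (α p * star (α p') + α p * v p p' t + u p p' t * star (α p') + u p p' t * v p p' t +
          (1 + t * u p p' t) * (1 + t * v p p' t) * d p p' t) := by
    intro t ht
    have ht' : (t : ℂ) ≠ 0 := by exact_mod_cast ht
    rw [expForm, Fintype.sum_sum_type, ← sum_add_distrib]
    refine sum_congr rfl fun p _ => ?_
    rw [Fintype.sum_sum_type, Fintype.sum_sum_type, ← sum_add_distrib, ← sum_add_distrib,
      ← sum_add_distrib]
    refine sum_congr rfl fun p' _ => ?_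
    simp only [Sum.elim_inl, Sum.elim_inr, inner_add_left, inner_add_right, inner_smul_left,
      inner_smul_right, Complex.exp_add, Complex.conj_ofReal, star_sub, star_div₀, star_one,
      Complex.star_def]
    have hu : Complex.exp (t * inner ℂ (z p') (γ p)) = 1 + t * u p p' t := by
      simp only [u]
      field_simp
      ring
    have hv : Complex.exp (t * inner ℂ (γ p') (z p)) = 1 + t * v p p' t := by
      simp only [v]
      field_simp
      ring
    have hd : Complex.exp (t * (t * inner ℂ (γ p') (γ p))) = 1 + t ^ 2 * d p p' t := by
      simp only [d]
      rw [← mul_assoc, ← sq]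
      field_simp
      ring
    have hud : Complex.exp (t * (inner ℂ (z p') (γ p) + t * inner ℂ (γ p') (γ p))) =
        (1 + t * u p p' t) * (1 + t ^ 2 * d p p' t) := by
      rw [mul_add, Complex.exp_add, hu, hd]
    rw [hu, hv, hud]
    field_simp
    ring
  have hlim : Tendsto (fun t : ℝ => (∑ p, ∑ p', Complex.exp (inner ℂ (z p') (z p)) *
        (α p * star (α p') + α p * v p p' t + u p p' t * star (α p') + u p p' t * v p p' t +
          (1 + t * u p p' t) * (1 + t * v p p' t) * d p p' t)).re) (𝓝[≠] 0)
      (𝓝 (∑ p, ∑ p', Complex.exp (inner ℂ (z p') (z p)) *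
        (α p * star (α p') + α p * inner ℂ (γ p') (z p) + inner ℂ (z p') (γ p) * star (α p') +
          inner ℂ (z p') (γ p) * inner ℂ (γ p') (z p) +
          (1 + (0 : ℝ) * inner ℂ (z p') (γ p)) * (1 + (0 : ℝ) * inner ℂ (γ p') (z p)) *
            inner ℂ (γ p') (γ p))).re) := by
    refine (Complex.continuous_re.tendsto _).comp ?_
    refine tendsto_finsetSum _ fun p _ => tendsto_finsetSum _ fun p' _ => ?_
    have h0 : Tendsto (fun t : ℝ => (t : ℂ)) (𝓝[≠] 0) (𝓝 ((0 : ℝ) : ℂ)) :=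
      (Complex.continuous_ofReal.tendsto 0).mono_left nhdsWithin_le_nhds
    have hu : Tendsto (u p p') (𝓝[≠] 0) (𝓝 _) := tendsto_exp_sub_one_div (inner ℂ (z p') (γ p))
    have hv : Tendsto (v p p') (𝓝[≠] 0) (𝓝 _) := tendsto_exp_sub_one_div (inner ℂ (γ p') (z p))
    have hd : Tendsto (d p p') (𝓝[≠] 0) (𝓝 _) := tendsto_exp_sq_sub_one_div (inner ℂ (γ p') (γ p))
    exact tendsto_const_nhds.mul (((((tendsto_const_nhds.add (tendsto_const_nhds.mul hv)).add
      (hu.mul tendsto_const_nhds)).add (hu.mul hv))).add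
        (((tendsto_const_nhds.add (h0.mul hu)).mul (tendsto_const_nhds.add (h0.mul hv))).mul hd))
  have hnn := ge_of_tendsto (b := 0) hlim (by
    filter_upwards [self_mem_nhdsWithin] with t ht
    rw [← hexp t ht]
    exact expForm_re_nonneg _ _)
  convert! hnn using 6 <;> · push_cast; ring

end FockDerivative

/-! ### Positivity and lower bounds for the Szegő covariances. -/

section Szego

open Finset
open scoped ComplexOrder

variable {m : ℕ} {ι : Type*}

theorem norm_heisenbergSzego (z w : EuclideanSpace ℂ (Fin m)) :
    ‖heisenbergSzego z 0 w 0‖ = (1 / Real.pi ^ m) * Real.exp (-(dist z w ^ 2 / 2)) := by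
  rw [heisenbergSzego, norm_mul, Complex.norm_exp, dist_eq_norm]
  congr 1
  · simp [abs_of_pos Real.pi_pos]
  · congr 1
    simp only [Complex.sub_re, Complex.add_re, Complex.mul_re, Complex.I_re, Complex.I_im,
      Complex.ofReal_re, Complex.ofReal_im, Complex.ofReal_zero, sub_self]
    simp

/-- The gauge factor that moves the base point of the kernel. -/
noncomputable def szegoGauge (w₀ z : EuclideanSpace ℂ (Fin m)) : ℂ :=
  Complex.exp (inner ℂ w₀ z - (‖w₀‖ ^ 2 / 2 : ℝ) - (‖z‖ ^ 2 / 2 : ℝ))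

theorem szegoGauge_self (w₀ : EuclideanSpace ℂ (Fin m)) : szegoGauge w₀ w₀ = 1 := by
  rw [szegoGauge, inner_self_eq_norm_sq_to_K, Complex.exp_eq_one_iff]
  refine ⟨0, ?_⟩
  push_cast
  simp only [Complex.coe_algebraMap]
  ring

/-- Heisenberg translation: up to a factor of the form $g(z)\overline{g(w)}$ the kernel is the
exponential kernel centred at any `w₀`, so any point may be taken as the origin. -/
theorem heisenbergSzego_eq (w₀ z w : EuclideanSpace ℂ (Fin m)) :
    heisenbergSzego z 0 w 0 = 1 / (Real.pi : ℂ) ^ m *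
      (szegoGauge w₀ z * star (szegoGauge w₀ w) * Complex.exp (inner ℂ (w - w₀) (z - w₀))) := by
  rw [heisenbergSzego, szegoGauge, szegoGauge, Complex.star_def, ← Complex.exp_conj,
    ← Complex.exp_add, ← Complex.exp_add, sum_mul_star_eq_inner]
  congr 2
  have hn : ‖z - w‖ ^ 2 = ‖z‖ ^ 2 - 2 * (inner ℂ w z).re + ‖w‖ ^ 2 := by
    rw [norm_sub_rev, @norm_sub_sq ℂ]
    simp only [RCLike.re_eq_complex_re]
    ring
  have hs : inner ℂ w₀ w₀ = ((‖w₀‖ ^ 2 : ℝ) : ℂ) := by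
    rw [inner_self_eq_norm_sq_to_K]
    push_cast
    rfl
  have hw : inner ℂ w z = ((inner ℂ w z).re : ℂ) + (inner ℂ w z).im * Complex.I :=
    (Complex.re_add_im _).symm
  rw [hn]
  simp only [map_sub, Complex.conj_ofReal, inner_conj_symm, inner_sub_left, inner_sub_right, hs]
  push_cast
  linear_combination -hw

variable [Fintype ι]

theorem star_heisenbergSzego (z w : EuclideanSpace ℂ (Fin m)) :
    star (heisenbergSzego z 0 w 0) = heisenbergSzego w 0 z 0 := by
  rw [heisenbergSzego_eq 0, heisenbergSzego_eq 0 w z]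
  simp only [Complex.star_def, map_mul, map_div₀, map_pow, map_one, Complex.conj_ofReal,
    ← Complex.exp_conj, inner_conj_symm, Complex.conj_conj]
  ring

omit [Fintype ι] in
theorem isHermitian_covA (z : ι → EuclideanSpace ℂ (Fin m)) : (covA z).IsHermitian := by
  ext p p'
  simp only [conjTranspose_apply, covA, of_apply, star_heisenbergSzego]

theorem star_dotProduct_covA (z : ι → EuclideanSpace ℂ (Fin m)) (w₀ : EuclideanSpace ℂ (Fin m))
    (x : ι → ℂ) : star x ⬝ᵥ covA z *ᵥ x = 1 / (Real.pi : ℂ) ^ m *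
      expForm (fun p => star (x p) * szegoGauge w₀ (z p)) (fun p => z p - w₀) := by
  simp only [dotProduct, mulVec, expForm, mul_sum, covA, of_apply, Pi.star_apply]
  refine sum_congr rfl fun p _ => sum_congr rfl fun p' _ => ?_
  rw [heisenbergSzego_eq w₀]
  simp only [star_mul', star_star]
  ring

theorem re_star_dotProduct_covA (z : ι → EuclideanSpace ℂ (Fin m))
    (w₀ : EuclideanSpace ℂ (Fin m)) (x : ι → ℂ) :
    (star x ⬝ᵥ covA z *ᵥ x).re = 1 / Real.pi ^ m *
      (expForm (fun p => star (x p) * szegoGauge w₀ (z p)) (fun p => z p - w₀)).re := by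
  rw [star_dotProduct_covA z w₀, show 1 / (Real.pi : ℂ) ^ m = ((1 / Real.pi ^ m : ℝ) : ℂ) by
    push_cast; rfl, Complex.re_ofReal_mul]

/-- The inverse of the lower bound for the least eigenvalue of `covA`. -/
noncomputable def covAConst (c : ℝ) (m N : ℕ) : ℝ :=
  N * (Real.pi ^ m * ((1 + 1 / c ^ 2) ^ (N - 1) * ((N - 1)! : ℝ)))

variable [DecidableEq ι]

theorem norm_sq_le_covA {c : ℝ} (hc : 0 < c) {z : ι → EuclideanSpace ℂ (Fin m)}
    (hz : z ∈ separated m ι c) (x : ι → ℂ) :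
    ∑ p, ‖x p‖ ^ 2 ≤ covAConst c m (Fintype.card ι) * (star x ⬝ᵥ covA z *ᵥ x).re := by
  have : ∀ p, ‖x p‖ ^ 2 ≤ Real.pi ^ m * ((1 + 1 / c ^ 2) ^ (Fintype.card ι - 1) *
      ((Fintype.card ι - 1)! : ℝ)) * (star x ⬝ᵥ covA z *ᵥ x).re := by
    intro p
    have h := norm_sq_le_expForm hc (fun p' => star (x p') * szegoGauge (z p) (z p'))
      (fun p' => z p' - z p) p (sub_self _) fun p' hp' => by
        rw [← dist_eq_norm]
        exact hz p' p hp'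
    rw [szegoGauge_self, mul_one, norm_star] at h
    rw [re_star_dotProduct_covA z (z p)]
    refine h.trans_eq ?_
    have := (pow_pos Real.pi_pos m).ne'
    field_simp
  calc ∑ p, ‖x p‖ ^ 2 ≤ ∑ _p : ι, Real.pi ^ m * ((1 + 1 / c ^ 2) ^ (Fintype.card ι - 1) *
      ((Fintype.card ι - 1)! : ℝ)) * (star x ⬝ᵥ covA z *ᵥ x).re := sum_le_sum fun p _ => this p
    _ = _ := by rw [sum_const, card_univ, nsmul_eq_mul, covAConst]; ring

theorem covAConst_inv_pow_pos {c : ℝ} (hc : 0 < c) (m N : ℕ) :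
    0 < (covAConst c m N)⁻¹ ^ N := by
  rcases Nat.eq_zero_or_pos N with rfl | hN
  · simp
  · rw [covAConst]
    have := Real.pi_pos
    positivity

theorem le_norm_det_covA {c : ℝ} (hc : 0 < c) {z : ι → EuclideanSpace ℂ (Fin m)}
    (hz : z ∈ separated m ι c) :
    (covAConst c m (Fintype.card ι))⁻¹ ^ Fintype.card ι ≤ ‖(covA z).det‖ := by
  have hH := isHermitian_covA z
  have hev : ∀ i, (covAConst c m (Fintype.card ι))⁻¹ ≤ hH.eigenvalues i := by
    intro i
    have h1 := norm_sq_le_covA hc hz (hH.eigenvectorBasis i).ofLp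
    have h2 : ∑ p, ‖(hH.eigenvectorBasis i).ofLp p‖ ^ 2 = 1 := by
      rw [← EuclideanSpace.norm_sq_eq, hH.eigenvectorBasis.orthonormal.1 i, one_pow]
    have h3 := hH.eigenvalues_eq i
    rw [RCLike.re_eq_complex_re] at h3
    rw [h2, ← h3] at h1
    have : Nonempty ι := ⟨i⟩
    have hpos : 0 < covAConst c m (Fintype.card ι) := by
      have := Real.pi_pos
      have : 0 < Fintype.card ι := Fintype.card_pos
      rw [covAConst]
      positivity
    rw [inv_le_iff_one_le_mul₀' hpos]
    exact h1
  have hpos : 0 ≤ (covAConst c m (Fintype.card ι))⁻¹ := by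
    have := Real.pi_pos
    rw [covAConst]
    positivity
  rw [hH.det_eq_prod_eigenvalues, norm_prod, ← card_univ, ← prod_const]
  refine prod_le_prod (fun _ _ => hpos) fun i _ => ?_
  rw [RCLike.norm_ofReal]
  exact (hev i).trans (le_abs_self _)

theorem posDef_covA {c : ℝ} (hc : 0 < c) {z : ι → EuclideanSpace ℂ (Fin m)}
    (hz : z ∈ separated m ι c) : (covA z).PosDef := by
  have hH := isHermitian_covA z
  have hps : (covA z).PosSemidef := by
    refine .of_dotProduct_mulVec_nonneg hH fun x => ?_
    rw [Complex.nonneg_iff]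
    refine ⟨?_, (hH.im_star_dotProduct_mulVec_self x).symm⟩
    rw [re_star_dotProduct_covA z 0]
    have := Real.pi_pos
    exact mul_nonneg (by positivity) (expForm_re_nonneg _ _)
  rw [hps.posDef_iff_det_ne_zero]
  intro h
  have h1 := le_norm_det_covA hc hz
  rw [h, norm_zero] at h1
  exact h1.not_gt (covAConst_inv_pow_pos hc _ _)

omit [Fintype ι] [DecidableEq ι] in
theorem isHermitian_covC (z : ι → EuclideanSpace ℂ (Fin m)) : (covC z).IsHermitian := by
  ext a b
  simp only [conjTranspose_apply, covC, of_apply, star_mul', star_heisenbergSzego, star_add,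
    star_sub, star_star, eq_comm (a := b.2)]
  congr 1
  split_ifs <;> simp only [star_one, star_zero] <;> ring

omit [DecidableEq ι] in
theorem posSemidef_fromBlocks_cov (z : ι → EuclideanSpace ℂ (Fin m)) :
    (fromBlocks (covA z) (covB z) (covB z)ᴴ (covC z)).PosSemidef := by
  have hH : (fromBlocks (covA z) (covB z) (covB z)ᴴ (covC z)).IsHermitian :=
    IsHermitian.fromBlocks (isHermitian_covA z) rfl (isHermitian_covC z)
  refine .of_dotProduct_mulVec_nonneg hH fun x => ?_
  rw [Complex.nonneg_iff]
  refine ⟨?_, (hH.im_star_dotProduct_mulVec_self x).symm⟩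
  let β : ι → EuclideanSpace ℂ (Fin m) := fun p => WithLp.toLp 2 fun q => star (x (Sum.inr (p, q)))
  let g : ι → ℝ := fun p => Real.exp (-‖z p‖ ^ 2 / 2)
  have hg : ∀ p, szegoGauge 0 (z p) = g p := by
    intro p
    simp only [szegoGauge, inner_zero_left, norm_zero, g]
    push_cast
    congr 1
    ring
  have hS : ∀ p p', heisenbergSzego (z p) 0 (z p') 0 =
      1 / (Real.pi : ℂ) ^ m * (g p * g p' * Complex.exp (inner ℂ (z p') (z p))) := by
    intro p p'
    rw [heisenbergSzego_eq 0, hg, hg, sub_zero, sub_zero, Complex.star_def, Complex.conj_ofReal]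
  have hβ : ∀ p (w : EuclideanSpace ℂ (Fin m)),
      inner ℂ w (β p) = ∑ q, star (x (Sum.inr (p, q))) * star (w q) := by
    intro p w
    rw [← sum_mul_star_eq_inner]
  have hβ' : ∀ p (w : EuclideanSpace ℂ (Fin m)),
      inner ℂ (β p) w = ∑ q, w q * x (Sum.inr (p, q)) := by
    intro p w
    rw [← sum_mul_star_eq_inner]
    simp [β]
  -- The values receive the shift $-\langle z_p,\beta_p\rangle$ because `covB` and `covC` involve
  -- only differences of points: $\langle z_{p'},\beta_p\rangle$ must become $\langle
  -- z_{p'}-z_p,\beta_p\rangle$.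
  have key : star x ⬝ᵥ fromBlocks (covA z) (covB z) (covB z)ᴴ (covC z) *ᵥ x =
      ((1 / Real.pi ^ m : ℝ) : ℂ) * ∑ p, ∑ p', Complex.exp (inner ℂ (z p') (z p)) *
      ((g p * (star (x (Sum.inl p)) - inner ℂ (z p) (β p)) + inner ℂ (z p') ((g p : ℂ) • β p)) *
        (star (g p' * (star (x (Sum.inl p')) - inner ℂ (z p') (β p'))) +
          inner ℂ ((g p' : ℂ) • β p') (z p)) +
        inner ℂ ((g p' : ℂ) • β p') ((g p : ℂ) • β p)) := by
    have hR : ∀ p p', ((1 / Real.pi ^ m : ℝ) : ℂ) * (Complex.exp (inner ℂ (z p') (z p)) *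
      ((g p * (star (x (Sum.inl p)) - inner ℂ (z p) (β p)) + inner ℂ (z p') ((g p : ℂ) • β p)) *
        (star (g p' * (star (x (Sum.inl p')) - inner ℂ (z p') (β p'))) +
          inner ℂ ((g p' : ℂ) • β p') (z p)) +
        inner ℂ ((g p' : ℂ) • β p') ((g p : ℂ) • β p))) =
        star (x (Sum.inl p)) * (covA z p p' * x (Sum.inl p')) +
        star (x (Sum.inl p)) * ∑ q', covB z p (p', q') * x (Sum.inr (p', q')) +
        (∑ q, star (x (Sum.inr (p, q))) * ((covB z)ᴴ (p, q) p' * x (Sum.inl p')) +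
        ∑ q, star (x (Sum.inr (p, q))) * ∑ q', covC z (p, q) (p', q') * x (Sum.inr (p', q'))) := by
      intro p p'
      have hB : ∑ q', covB z p (p', q') * x (Sum.inr (p', q')) =
          heisenbergSzego (z p) 0 (z p') 0 * (inner ℂ (β p') (z p) - inner ℂ (β p') (z p')) := by
        rw [hβ', hβ', ← sum_sub_distrib, mul_sum]
        refine sum_congr rfl fun q _ => ?_
        simp only [covB, of_apply]
        ring
      have hB' : ∑ q, star (x (Sum.inr (p, q))) * ((covB z)ᴴ (p, q) p' * x (Sum.inl p')) =
          heisenbergSzego (z p) 0 (z p') 0 * (inner ℂ (z p') (β p) - inner ℂ (z p) (β p)) *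
            x (Sum.inl p') := by
        rw [hβ, hβ, ← sum_sub_distrib, mul_sum, sum_mul]
        refine sum_congr rfl fun q _ => ?_
        simp only [covB, of_apply, conjTranspose_apply, star_mul', star_heisenbergSzego, star_sub]
        ring
      have hC : ∑ q, star (x (Sum.inr (p, q))) *
            ∑ q', covC z (p, q) (p', q') * x (Sum.inr (p', q')) =
          heisenbergSzego (z p) 0 (z p') 0 * ((inner ℂ (z p') (β p) - inner ℂ (z p) (β p)) *
            (inner ℂ (β p') (z p) - inner ℂ (β p') (z p')) + inner ℂ (β p') (β p)) := by
        have h1 : ∀ q, ∑ q', covC z (p, q) (p', q') * x (Sum.inr (p', q')) =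
            heisenbergSzego (z p) 0 (z p') 0 * (x (Sum.inr (p', q)) +
              (star (z p' q) - star (z p q)) *
                (inner ℂ (β p') (z p) - inner ℂ (β p') (z p'))) := by
          intro q
          have h2 : x (Sum.inr (p', q)) =
              ∑ q', (if q = q' then 1 else 0) * x (Sum.inr (p', q')) := by simp
          rw [hβ', hβ', ← sum_sub_distrib, mul_sum]
          conv_rhs => rw [h2]
          rw [← sum_add_distrib, mul_sum]
          refine sum_congr rfl fun q' _ => ?_
          simp only [covC, of_apply]
          ring
        have h3 : inner ℂ (β p') (β p) = ∑ q, star (x (Sum.inr (p, q))) * x (Sum.inr (p', q)) := by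
          rw [hβ']
        simp_rw [h1]
        rw [h3, hβ p, hβ p, ← sum_sub_distrib, sum_mul, ← sum_add_distrib, mul_sum]
        refine sum_congr rfl fun q _ => ?_
        ring
      rw [hB, hB', hC]
      simp only [covA, of_apply, hS, inner_smul_left, inner_smul_right, Complex.conj_ofReal,
        Complex.star_def, map_mul, map_sub, Complex.conj_conj, inner_conj_symm]
      push_cast
      ring
    rw [mul_sum]
    simp_rw [mul_sum univ _ ((1 / Real.pi ^ m : ℝ) : ℂ), hR, sum_add_distrib]
    simp only [dotProduct, mulVec, Fintype.sum_sum_type, fromBlocks_apply₁₁, fromBlocks_apply₁₂,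
      fromBlocks_apply₂₁, fromBlocks_apply₂₂, Pi.star_apply, mul_add, sum_add_distrib,
      Fintype.sum_prod_type, mul_sum]
    have hc : ∑ p, ∑ p', ∑ q, star (x (Sum.inr (p, q))) * ((covB z)ᴴ (p, q) p' * x (Sum.inl p')) =
        ∑ p, ∑ q, ∑ p', star (x (Sum.inr (p, q))) * ((covB z)ᴴ (p, q) p' * x (Sum.inl p')) :=
      sum_congr rfl fun p _ => sum_comm
    have hd : ∑ p, ∑ p', ∑ q, ∑ q', star (x (Sum.inr (p, q))) *
          (covC z (p, q) (p', q') * x (Sum.inr (p', q'))) =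
        ∑ p, ∑ q, ∑ p', ∑ q', star (x (Sum.inr (p, q))) *
          (covC z (p, q) (p', q') * x (Sum.inr (p', q'))) :=
      sum_congr rfl fun p _ => sum_comm
    rw [hc, hd]
    ring
  rw [key, Complex.re_ofReal_mul]
  have := Real.pi_pos
  exact mul_nonneg (by positivity) (exp_deriv_form_nonneg _ _ _)

/-- Needed for `complexGaussian` to have covariance $I_k\otimes\Lambda$, being built from a positive
square root. -/
theorem posSemidef_covLambda {c : ℝ} (hc : 0 < c) {z : ι → EuclideanSpace ℂ (Fin m)}
    (hz : z ∈ separated m ι c) : (covLambda z).PosSemidef := by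
  have hA := posDef_covA hc hz
  have : Invertible (covA z) := hA.isUnit.invertible
  exact (PosDef.fromBlocks₁₁ (covB z) (covC z) hA).1 (posSemidef_fromBlocks_cov z)

end Szego

/-! ### Choosing few edges of large total squared length. -/

section CutSelection

open Finset

/-- Edges covering every gap of a monotone sequence from left to right carry at least the sum of
the squared gaps. -/
theorem exists_subset_sum_sq_gap_le {σ : Type*} [DecidableEq σ] {N : ℕ} {g : ℕ → ℝ}
    (hg : Monotone g) (T : Finset σ) (a b : σ → ℕ)
    (h : ∀ i < N, ∃ v ∈ T, a v ≤ i ∧ i < b v) :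
    ∃ U ⊆ T, #U ≤ N ∧ (∀ v ∈ U, a v < b v) ∧
      ∑ i ∈ range N, (g (i + 1) - g i) ^ 2 ≤ ∑ v ∈ U, (g (b v) - g (a v)) ^ 2 := by
  rcases Nat.eq_zero_or_pos N with rfl | hN
  · exact ⟨∅, by simp⟩
  have : Nonempty σ := ⟨(h 0 hN).choose⟩
  choose! u hu' using h
  have hu : ∀ i ∈ range N, u i ∈ T ∧ a (u i) ≤ i ∧ i < b (u i) := fun i hi =>
    hu' i (mem_range.1 hi)
  refine ⟨(range N).image u, ?_, ?_, ?_, ?_⟩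
  · intro v hv
    obtain ⟨i, hi, rfl⟩ := mem_image.1 hv
    exact (hu i hi).1
  · exact card_image_le.trans_eq (card_range N)
  · intro v hv
    obtain ⟨i, hi, rfl⟩ := mem_image.1 hv
    exact (hu i hi).2.1.trans_lt (hu i hi).2.2
  · rw [← sum_fiberwise_of_maps_to (t := (range N).image u) fun i hi => mem_image_of_mem u hi]
    refine sum_le_sum fun v hv => ?_
    have hlt : a v ≤ b v := by
      obtain ⟨i, hi, rfl⟩ := mem_image.1 hv
      exact ((hu i hi).2.1.trans_lt (hu i hi).2.2).le
    have hgap : ∀ i ∈ Ico (a v) (b v), 0 ≤ g (i + 1) - g i := fun i _ =>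
      sub_nonneg.2 (hg (Nat.le_succ i))
    calc ∑ i ∈ range N with u i = v, (g (i + 1) - g i) ^ 2
        ≤ ∑ i ∈ Ico (a v) (b v), (g (i + 1) - g i) ^ 2 := by
          refine sum_le_sum_of_subset_of_nonneg ?_ fun _ _ _ => sq_nonneg _
          intro i hi
          obtain ⟨hi, hv⟩ := mem_filter.1 hi
          rw [← hv]
          exact mem_Ico.2 (hu i hi).2
      _ ≤ (∑ i ∈ Ico (a v) (b v), (g (i + 1) - g i)) ^ 2 := by
          rw [sq (∑ i ∈ Ico (a v) (b v), _), sum_mul]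
          refine sum_le_sum fun i hi => ?_
          rw [sq]
          exact mul_le_mul_of_nonneg_left (single_le_sum hgap hi) (hgap i hi)
      _ = (g (b v) - g (a v)) ^ 2 := by rw [sum_Ico_sub g hlt]

/-- Sort the values and use the cuts into initial segments, once per direction, whence the factors
2. The factor `N` is Cauchy–Schwarz over the `N` gaps. -/
theorem exists_subset_sum_sq_le {σ : Type*} [DecidableEq σ] {N : ℕ} (f : Fin (N + 1) → ℝ)
    (T : Finset σ) (e₁ e₂ : σ → Fin (N + 1))
    (h : ∀ S : Finset (Fin (N + 1)), S.Nonempty → Sᶜ.Nonempty → ∃ v ∈ T, e₁ v ∈ S ∧ e₂ v ∉ S)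
    (p q : Fin (N + 1)) :
    ∃ U ⊆ T, #U ≤ 2 * N ∧
      2 * (f q - f p) ^ 2 ≤ N * ∑ v ∈ U, (f (e₁ v) - f (e₂ v)) ^ 2 := by
  let ρ := Tuple.sort f
  have hρ : Monotone (f ∘ ρ) := Tuple.monotone_sort f
  let g : ℕ → ℝ := fun i => f (ρ ⟨min i N, by omega⟩)
  have hg : Monotone g := fun i j hij => hρ (Fin.mk_le_mk.2 (min_le_min_right N hij))
  let pos : Fin (N + 1) → ℕ := fun v => (ρ.symm v : Fin (N + 1))
  have hpos : ∀ v, pos v ≤ N := fun v => Nat.lt_succ_iff.1 (ρ.symm v).2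
  have hfg : ∀ v, f v = g (pos v) := by
    intro v
    have : (⟨min (pos v) N, by omega⟩ : Fin (N + 1)) = ρ.symm v :=
      Fin.ext (min_eq_left (hpos v))
    simp only [g, this, Equiv.apply_symm_apply]
  have hposρ : ∀ i : Fin (N + 1), pos (ρ i) = i := fun i => by
    simp only [pos, Equiv.symm_apply_apply]
  have hS : ∀ i < N, (univ.filter fun v => pos v ≤ i).Nonempty ∧
      (univ.filter fun v => pos v ≤ i)ᶜ.Nonempty := by
    intro i hi
    refine ⟨⟨ρ 0, ?_⟩, ⟨ρ (Fin.last N), ?_⟩⟩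
    · rw [mem_filter, hposρ]
      exact ⟨mem_univ _, Nat.zero_le i⟩
    · rw [mem_compl, mem_filter, hposρ]
      simpa using hi
  obtain ⟨U₁, hU₁, hc₁, hlt₁, hs₁⟩ := exists_subset_sum_sq_gap_le (N := N) hg T
    (fun v => pos (e₁ v)) (fun v => pos (e₂ v)) (by
      intro i hi
      obtain ⟨v, hv, h1, h2⟩ := h _ (hS i hi).1 (hS i hi).2
      exact ⟨v, hv, (mem_filter.1 h1).2, by simpa using h2⟩)
  obtain ⟨U₂, hU₂, hc₂, hlt₂, hs₂⟩ := exists_subset_sum_sq_gap_le (N := N) hg T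
    (fun v => pos (e₂ v)) (fun v => pos (e₁ v)) (by
      intro i hi
      obtain ⟨v, hv, h1, h2⟩ := h _ (hS i hi).2 (by rw [compl_compl]; exact (hS i hi).1)
      exact ⟨v, hv, by simpa using h2, by simpa using h1⟩)
  -- No edge points both ways, so no square is counted twice.
  have hdisj : Disjoint U₁ U₂ := by
    rw [Finset.disjoint_left]
    intro v h1 h2
    exact (hlt₁ v h1).asymm (hlt₂ v h2)
  refine ⟨U₁ ∪ U₂, union_subset hU₁ hU₂, (card_union_le _ _).trans (by omega), ?_⟩
  rw [sum_union hdisj]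
  have hcs : (f q - f p) ^ 2 ≤ N * ∑ i ∈ range N, (g (i + 1) - g i) ^ 2 := by
    have h1 := sq_sum_le_card_mul_sum_sq (s := range N) (f := fun i => g (i + 1) - g i)
    rw [card_range, sum_range_sub] at h1
    refine le_trans ?_ h1
    rw [hfg q, hfg p]
    have hq := hg (hpos q)
    have hp := hg (hpos p)
    have hq0 := hg (Nat.zero_le (pos q))
    have hp0 := hg (Nat.zero_le (pos p))
    rw [sq_le_sq, abs_of_nonneg (sub_nonneg.2 (hg (Nat.zero_le N)))]
    exact abs_le.2 ⟨by linarith, by linarith⟩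
  have e1 : ∑ v ∈ U₁, (f (e₁ v) - f (e₂ v)) ^ 2 =
      ∑ v ∈ U₁, (g (pos (e₂ v)) - g (pos (e₁ v))) ^ 2 :=
    sum_congr rfl fun v _ => by rw [hfg, hfg (e₂ v)]; ring
  have e2 : ∑ v ∈ U₂, (f (e₁ v) - f (e₂ v)) ^ 2 =
      ∑ v ∈ U₂, (g (pos (e₁ v)) - g (pos (e₂ v))) ^ 2 :=
    sum_congr rfl fun v _ => by rw [hfg, hfg (e₂ v)]
  rw [e1, e2]
  have := mul_le_mul_of_nonneg_left (add_le_add hs₁ hs₂) (Nat.cast_nonneg (α := ℝ) N)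
  linarith

end CutSelection

/-! ### The actual covariance matrix: entry bounds and normalization. -/

section CovMat

open Finset

variable {ι : Type*} {k m : ℕ}

/-- The joint covariance matrix of the values and the derivatives. -/
noncomputable def covMat (z : ι → EuclideanSpace ℂ (Fin m)) :
    Matrix (ι × Option (Fin m)) (ι × Option (Fin m)) ℂ :=
  Matrix.of fun a b => match a.2, b.2 with
    | none, none => covA z a.1 b.1
    | none, some q' => covB z a.1 (b.1, q')
    | some q, none => (covB z)ᴴ (a.1, q) b.1
    | some q, some q' => covC z (a.1, q) (b.1, q')

theorem restrictPoints_covMat (z : ι → EuclideanSpace ℂ (Fin m)) (W : Finset ι) :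
    restrictPoints (covMat z) W = covMat fun p : W => z p := by
  ext ⟨p, _ | q⟩ ⟨p', _ | q'⟩ <;> rfl

theorem norm_coord_sub_le (z w : EuclideanSpace ℂ (Fin m)) (q : Fin m) :
    ‖z q - w q‖ ≤ dist z w := by
  rw [dist_eq_norm]
  exact PiLp.norm_apply_le (z - w) q

theorem norm_covMat_le (z : ι → EuclideanSpace ℂ (Fin m)) (a b : ι × Option (Fin m)) :
    ‖covMat z a b‖ ≤
      (1 + dist (z a.1) (z b.1)) ^ 2 * Real.exp (-(dist (z a.1) (z b.1) ^ 2 / 2)) := by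
  have hS : ∀ p p', ‖heisenbergSzego (z p) 0 (z p') 0‖ ≤
      Real.exp (-(dist (z p) (z p') ^ 2 / 2)) := by
    intro p p'
    rw [norm_heisenbergSzego]
    refine mul_le_of_le_one_left (Real.exp_pos _).le ?_
    rw [div_le_one (pow_pos Real.pi_pos m)]
    exact one_le_pow₀ (by linarith [Real.pi_gt_three])
  obtain ⟨p, o⟩ := a
  obtain ⟨p', o'⟩ := b
  have hd : 0 ≤ dist (z p) (z p') := dist_nonneg
  have main : ∀ x : ℂ, ‖x‖ ≤ (1 + dist (z p) (z p')) ^ 2 →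
      ‖x * heisenbergSzego (z p) 0 (z p') 0‖ ≤
        (1 + dist (z p) (z p')) ^ 2 * Real.exp (-(dist (z p) (z p') ^ 2 / 2)) := by
    intro x hx
    rw [norm_mul]
    exact mul_le_mul hx (hS p p') (norm_nonneg _) (by positivity)
  rcases o with _ | q <;> rcases o' with _ | q'
  · have := main 1 (by rw [norm_one]; nlinarith)
    rwa [one_mul] at this
  · exact main _ ((norm_coord_sub_le _ _ q').trans (by nlinarith))
  · have h1 := main (star (z p' q - z p q)) (by
      rw [norm_star]
      exact (norm_coord_sub_le _ _ q).trans (by rw [dist_comm]; nlinarith))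
    have h2 : covMat z (p, some q) (p', none) =
        star (z p' q - z p q) * heisenbergSzego (z p) 0 (z p') 0 := by
      simp only [covMat, of_apply, conjTranspose_apply, covB, star_mul', star_heisenbergSzego]
    rwa [h2]
  · refine main ((if q = q' then 1 else 0) +
      (star (z p' q) - star (z p q)) * (z p q' - z p' q')) ?_
    refine (norm_add_le _ _).trans ?_
    rw [norm_mul, ← star_sub, norm_star]
    have h1 : ‖(if q = q' then 1 else 0 : ℂ)‖ ≤ 1 := by split_ifs <;> simp
    have h2 := norm_coord_sub_le (z p) (z p') q'
    have h3 := norm_coord_sub_le (z p') (z p) q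
    rw [dist_comm] at h3
    have h4 := mul_le_mul h3 h2 (norm_nonneg _) hd
    nlinarith

theorem one_add_sq_mul_exp_le (d : ℝ) : (1 + d) ^ 2 * Real.exp (-(d ^ 2 / 2)) ≤ 4 := by
  rw [Real.exp_neg, ← div_eq_mul_inv, div_le_iff₀ (Real.exp_pos _)]
  have := Real.add_one_le_exp (d ^ 2 / 2)
  nlinarith [sq_nonneg (d - 1)]

theorem separated_comp {z : ι → EuclideanSpace ℂ (Fin m)} {c : ℝ} (hz : z ∈ separated m ι c)
    {α : Type*} {e : α → ι} (he : Function.Injective e) :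
    (fun p => z (e p)) ∈ separated m α c :=
  fun _ _ hpq => hz _ _ (he.ne hpq)

variable [Fintype ι] [DecidableEq ι]

/-- The normalizing factor of a point. -/
noncomputable def corrFactor (k m : ℕ) : ℂ :=
  (Real.pi : ℂ) ^ k * ((m - k)! : ℂ) / (m ! : ℂ) * (1 / (Real.pi : ℂ)) ^ k

theorem normalizedCorr_eq {c : ℝ} (hc : 0 < c) {z : ι → EuclideanSpace ℂ (Fin m)}
    (hz : z ∈ separated m ι c) :
    normalizedCorr k z = corrFactor k m ^ Fintype.card ι * blockCorr k (covMat z) := by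
  have h1 : schurCompl (covMat z) = covLambda z := rfl
  have h2 : blockA (covMat z) = covA z := rfl
  rw [normalizedCorr, zeroCorr, integral_prod_det_complexGaussian (posSemidef_covLambda hc hz),
    blockCorr, h1, h2, corrFactor]
  have h3 : 1 / ((Real.pi : ℂ) ^ Fintype.card ι * (covA z).det) ^ k =
      ((1 / (Real.pi : ℂ)) ^ k) ^ Fintype.card ι * ((covA z).det ^ k)⁻¹ := by
    rw [one_div, mul_pow, mul_inv, ← pow_mul, ← pow_mul, one_div, inv_pow, mul_comm k]
  rw [h3, mul_pow _ ((1 / (Real.pi : ℂ)) ^ k)]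
  ring

/-- The normalization is one factor per point and block sizes add up to the number of points, so it
leaves the sum over partitions. -/
theorem connectedCorr_eq {c : ℝ} (hc : 0 < c) {z : ι → EuclideanSpace ℂ (Fin m)}
    (hz : z ∈ separated m ι c) :
    connectedCorr k z = corrFactor k m ^ Fintype.card ι * ursellCorr k (covMat z) := by
  rw [connectedCorr, ursellCorr, mul_sum]
  refine sum_congr rfl fun G _ => ?_
  have : ∀ W : Finset ι, normalizedCorr k (fun p : W => z p) =
      corrFactor k m ^ #W * blockCorr k (restrictPoints (covMat z) W) := by
    intro W
    rw [normalizedCorr_eq hc (separated_comp hz Subtype.val_injective), Fintype.card_coe,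
      restrictPoints_covMat]
  simp_rw [this]
  rw [prod_mul_distrib, prod_pow_eq_pow_sum, G.sum_card_parts, card_univ]
  ring

theorem le_norm_ursellDen {c : ℝ} (hc : 0 < c) {z : ι → EuclideanSpace ℂ (Fin m)}
    (hz : z ∈ separated m ι c) :
    (∀ W, (blockA (restrictPoints (covMat z) W)).det ≠ 0) ∧
    ∏ W : Finset ι, ((covAConst c m #W)⁻¹ ^ #W) ^ denExponent k W ≤ ‖ursellDen k (covMat z)‖ := by
  have hW : ∀ W : Finset ι, (covAConst c m #W)⁻¹ ^ #W ≤
      ‖(blockA (restrictPoints (covMat z) W)).det‖ := by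
    intro W
    have := le_norm_det_covA hc (separated_comp hz (Subtype.val_injective (p := (· ∈ W))))
    rw [Fintype.card_coe] at this
    rw [restrictPoints_covMat]
    exact this
  refine ⟨fun W => norm_pos_iff.1 ((covAConst_inv_pow_pos hc m #W).trans_le (hW W)), ?_⟩
  rw [ursellDen, norm_prod]
  refine prod_le_prod (fun W _ => pow_nonneg (covAConst_inv_pow_pos hc m #W).le _) fun W _ => ?_
  rw [norm_pow]
  exact pow_le_pow_left₀ (covAConst_inv_pow_pos hc m #W).le (hW W) _

end CovMat

/-! ### Gaussian decay of the connected correlation. -/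

section Decay

open Finset Topology

variable {k m N : ℕ}

theorem dist_le_maxDist {ι : Type*} [Finite ι] (z : ι → EuclideanSpace ℂ (Fin m)) (p q : ι) :
    dist (z p) (z q) ≤ maxDist z :=
  Metric.dist_le_diam_of_mem (Set.finite_range z).isBounded (Set.mem_range_self p)
    (Set.mem_range_self q)

theorem exists_dist_eq_maxDist {ι : Type*} [Fintype ι] [Nonempty ι]
    (z : ι → EuclideanSpace ℂ (Fin m)) : ∃ p q, dist (z p) (z q) = maxDist z := by
  obtain ⟨⟨p, q⟩, -, h⟩ := exists_max_image univ (fun x : ι × ι => dist (z x.1) (z x.2))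
    univ_nonempty
  refine ⟨p, q, (dist_le_maxDist z p q).antisymm ?_⟩
  refine Metric.diam_le_of_forall_dist_le dist_nonneg ?_
  rintro _ ⟨a, rfl⟩ _ ⟨b, rfl⟩
  exact h (a, b) (mem_univ _)

/-- Edges crossing every cut in both directions contain few edges of large total squared length. -/
theorem exists_subset_sum_sq_dist_le {σ : Type*} [DecidableEq σ]
    (z : Fin (N + 1) → EuclideanSpace ℂ (Fin m)) (T : Finset σ) (e₁ e₂ : σ → Fin (N + 1))
    (h : ∀ S : Finset (Fin (N + 1)), S.Nonempty → Sᶜ.Nonempty → ∃ v ∈ T, e₁ v ∈ S ∧ e₂ v ∉ S) :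
    ∃ U ⊆ T, #U ≤ 2 * N ∧
      2 * maxDist z ^ 2 ≤ N * ∑ v ∈ U, dist (z (e₁ v)) (z (e₂ v)) ^ 2 := by
  obtain ⟨p, q, hpq⟩ := exists_dist_eq_maxDist z
  rcases eq_or_ne (z p) (z q) with heq | hne
  · refine ⟨∅, empty_subset _, by simp, ?_⟩
    rw [← hpq, heq]
    simp
  -- Unit vector along a diameter: the real projection `f` onto it is 1-Lipschitz and separates `p`
  -- and `q` by exactly $R$.
  let w : EuclideanSpace ℂ (Fin m) := ((‖z q - z p‖⁻¹ : ℝ) : ℂ) • (z q - z p)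
  have hpos : ‖z q - z p‖ ≠ 0 := norm_ne_zero_iff.2 (sub_ne_zero.2 hne.symm)
  have hw : ‖w‖ = 1 := by
    rw [norm_smul, Complex.norm_real, Real.norm_of_nonneg (by positivity), inv_mul_cancel₀ hpos]
  let f : Fin (N + 1) → ℝ := fun v => (inner ℂ w (z v)).re
  have hf : ∀ a b, f a - f b = (inner ℂ w (z a - z b)).re := fun a b => by
    rw [inner_sub_right, Complex.sub_re]
  have hlip : ∀ a b, (f a - f b) ^ 2 ≤ dist (z a) (z b) ^ 2 := by
    intro a b
    rw [hf, ← sq_abs]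
    refine pow_le_pow_left₀ (abs_nonneg _) ?_ 2
    refine (Complex.abs_re_le_norm _).trans ((norm_inner_le_norm _ _).trans_eq ?_)
    rw [hw, one_mul, dist_eq_norm]
  have hfpq : f q - f p = maxDist z := by
    rw [hf, ← hpq, dist_comm, dist_eq_norm]
    simp only [w]
    rw [inner_smul_left, inner_self_eq_norm_sq_to_K, Complex.conj_ofReal]
    simp only [Complex.coe_algebraMap]
    rw [← Complex.ofReal_pow, ← Complex.ofReal_mul, Complex.ofReal_re]
    field_simp
  obtain ⟨U, hU, hc, hs⟩ := exists_subset_sum_sq_le f T e₁ e₂ h p q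
  refine ⟨U, hU, hc, ?_⟩
  rw [hfpq] at hs
  refine hs.trans (mul_le_mul_of_nonneg_left ?_ (Nat.cast_nonneg N))
  exact sum_le_sum fun v _ => hlip _ _

theorem norm_monomial_covMat_le (hN : 1 ≤ N) (z : Fin (N + 1) → EuclideanSpace ℂ (Fin m))
    (s : (Fin (N + 1) × Option (Fin m)) × (Fin (N + 1) × Option (Fin m)) →₀ ℕ)
    (h : ∀ S : Finset (Fin (N + 1)), S.Nonempty → Sᶜ.Nonempty →
      ∃ v ∈ s.support, v.1.1 ∈ S ∧ v.2.1 ∉ S) :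
    ‖∏ v ∈ s.support, covMat z v.1 v.2 ^ s v‖ ≤
      4 ^ (∑ v ∈ s.support, s v) *
        ((1 + maxDist z) ^ (4 * N) * Real.exp (-(maxDist z ^ 2 / N))) := by
  obtain ⟨U, hU, hc, hs⟩ := exists_subset_sum_sq_dist_le z s.support (fun v => v.1.1)
    (fun v => v.2.1) h
  have hR : 0 ≤ maxDist z := Metric.diam_nonneg
  have hN' : (0 : ℝ) < N := by exact_mod_cast hN
  -- Each selected variable keeps one factor with its Gaussian decay; all other factors are bounded
  -- by 4.
  have hterm : ∀ v ∈ s.support, ‖covMat z v.1 v.2 ^ s v‖ ≤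
      4 ^ s v * (if v ∈ U then ‖covMat z v.1 v.2‖ else 1) := by
    intro v hv
    have h4 : ‖covMat z v.1 v.2‖ ≤ 4 := (norm_covMat_le z _ _).trans (one_add_sq_mul_exp_le _)
    rw [norm_pow]
    split_ifs
    · obtain ⟨j, hj⟩ := Nat.exists_eq_succ_of_ne_zero (Finsupp.mem_support_iff.1 hv)
      rw [hj, pow_succ]
      refine mul_le_mul_of_nonneg_right ?_ (norm_nonneg _)
      exact (pow_le_pow_left₀ (norm_nonneg _) h4 j).trans
        (pow_le_pow_right₀ (by norm_num) (Nat.le_succ j))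
    · rw [mul_one]
      exact pow_le_pow_left₀ (norm_nonneg _) h4 _
  have hprodU : ∏ v ∈ U, ‖covMat z v.1 v.2‖ ≤
      (1 + maxDist z) ^ (4 * N) * Real.exp (-(maxDist z ^ 2 / N)) := by
    calc ∏ v ∈ U, ‖covMat z v.1 v.2‖
        ≤ ∏ v ∈ U, ((1 + maxDist z) ^ 2 * Real.exp (-(dist (z v.1.1) (z v.2.1) ^ 2 / 2))) := by
          refine prod_le_prod (fun _ _ => norm_nonneg _) fun v _ => ?_
          refine (norm_covMat_le z _ _).trans ?_
          gcongr
          exact dist_le_maxDist z _ _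
      _ = (1 + maxDist z) ^ (2 * #U) *
          Real.exp (-((∑ v ∈ U, dist (z v.1.1) (z v.2.1) ^ 2) / 2)) := by
          rw [prod_mul_distrib, prod_const, ← pow_mul, ← Real.exp_sum, sum_neg_distrib, sum_div]
      _ ≤ _ := by
          refine mul_le_mul (pow_le_pow_right₀ (by linarith) (by omega)) ?_ (Real.exp_pos _).le
            (by positivity)
          refine Real.exp_le_exp.2 (neg_le_neg ?_)
          rw [div_le_iff₀ hN']
          linarith
  rw [norm_prod]
  refine (prod_le_prod (fun _ _ => norm_nonneg _) hterm).trans ?_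
  rw [prod_mul_distrib, prod_pow_eq_pow_sum]
  refine mul_le_mul_of_nonneg_left (le_trans (le_of_eq ?_) hprodU) (by positivity)
  rw [prod_ite_mem, inter_eq_right.2 hU]

/-- The decay of the numerator of the truncated correlation function. -/
theorem exists_norm_ursellNum_le (k m : ℕ) (hN : 1 ≤ N) :
    ∃ C : ℝ, 0 ≤ C ∧ ∀ z : Fin (N + 1) → EuclideanSpace ℂ (Fin m),
      ‖ursellNum k (covMat z)‖ ≤
        C * ((1 + maxDist z) ^ (4 * N) * Real.exp (-(maxDist z ^ 2 / N))) := by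
  refine ⟨∑ s ∈ (ursellPoly (Fin (N + 1)) k m).support,
    ‖(ursellPoly (Fin (N + 1)) k m).coeff s‖ * 4 ^ (∑ v ∈ s.support, s v), by positivity, ?_⟩
  intro z
  rw [← eval_ursellPoly, MvPolynomial.eval_eq, sum_mul]
  refine (norm_sum_le _ _).trans (sum_le_sum fun s hs => ?_)
  rw [norm_mul, mul_assoc]
  refine mul_le_mul_of_nonneg_left ?_ (norm_nonneg _)
  exact norm_monomial_covMat_le hN z s fun S hS hS' =>
    exists_edge_of_mem_support_ursellPoly hS hS' hs

theorem connectedCorr_isBigO (k m : ℕ) {c : ℝ} (hc : 0 < c) (hN : 1 ≤ N) :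
    (fun z : Fin (N + 1) → EuclideanSpace ℂ (Fin m) => connectedCorr k z)
      =O[𝓟 (separated m (Fin (N + 1)) c)]
    fun z => maxDist z ^ (4 * N) * Real.exp (-(maxDist z ^ 2 / N)) := by
  obtain ⟨C, hC0, hC⟩ := exists_norm_ursellNum_le k m hN
  let D : ℝ := ∏ W : Finset (Fin (N + 1)), ((covAConst c m #W)⁻¹ ^ #W) ^ denExponent k W
  have hD : 0 < D := prod_pos fun W _ => pow_pos (covAConst_inv_pow_pos hc m #W) _
  refine IsBigO.of_bound (‖corrFactor k m ^ (N + 1)‖ * (C * (1 / c + 1) ^ (4 * N) / D)) ?_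
  rw [eventually_principal]
  intro z hz
  have hR : c ≤ maxDist z := by
    refine (hz 0 (Fin.last N) ?_).trans (dist_le_maxDist z _ _)
    intro h0
    have := congrArg Fin.val h0
    simp only [Fin.val_zero, Fin.val_last] at this
    omega
  have hR0 : 0 < maxDist z := hc.trans_le hR
  obtain ⟨hdet, hden⟩ := le_norm_ursellDen (k := k) hc hz
  have hden0 : ‖ursellDen k (covMat z)‖ ≠ 0 := (hD.trans_le hden).ne'
  have h1 : ‖ursellCorr k (covMat z)‖ ≤ C * (1 / c + 1) ^ (4 * N) / D *
      (maxDist z ^ (4 * N) * Real.exp (-(maxDist z ^ 2 / N))) := by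
    have h2 := congrArg norm (ursellCorr_mul_ursellDen (k := k) (covMat z) hdet)
    rw [norm_mul] at h2
    -- Separation of two distinct points gives $R\ge c$, which replaces powers of $1+R$ by powers of
    -- $R$.
    have h3 : 1 + maxDist z ≤ (1 / c + 1) * maxDist z := by
      rw [add_mul, one_mul]
      have : 1 ≤ 1 / c * maxDist z := by
        rw [one_div_mul_eq_div, one_le_div hc]
        exact hR
      linarith
    have h4 : ‖ursellCorr k (covMat z)‖ * D ≤ C * ((1 / c + 1) ^ (4 * N) *
        (maxDist z ^ (4 * N) * Real.exp (-(maxDist z ^ 2 / N)))) := by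
      refine (mul_le_mul_of_nonneg_left hden (norm_nonneg _)).trans ?_
      rw [h2]
      refine (hC z).trans (mul_le_mul_of_nonneg_left ?_ hC0)
      rw [← mul_assoc, ← mul_pow]
      gcongr
    rw [← le_div_iff₀ hD] at h4
    refine h4.trans_eq ?_
    ring
  rw [connectedCorr_eq hc hz, norm_mul, Fintype.card_fin, mul_assoc,
    Real.norm_of_nonneg (by positivity)]
  exact mul_le_mul_of_nonneg_left h1 (norm_nonneg _)

theorem pow_mul_exp_neg_sq_isLittleO (hN : 1 ≤ N) :
    (fun R : ℝ => R ^ (4 * N) * Real.exp (-(R ^ 2 / N))) =o[atTop]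
      fun R => Real.exp (-(R ^ 2 / (N + 1 : ℕ))) := by
  have hN' : (0 : ℝ) < N := by exact_mod_cast hN
  have hb : (0 : ℝ) < 1 / N - 1 / (N + 1) := by
    rw [sub_pos]
    exact one_div_lt_one_div_of_lt hN' (by linarith)
  have h1 := (isLittleO_pow_exp_pos_mul_atTop (k := 2 * N) hb).comp_tendsto
    (tendsto_pow_atTop (α := ℝ) two_ne_zero)
  have h2 := h1.mul_isBigO (isBigO_refl (fun R : ℝ => Real.exp (-(R ^ 2 / N))) atTop)
  refine h2.congr (fun R => ?_) fun R => ?_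
  · simp only [Function.comp_apply]
    rw [← pow_mul]
    ring_nf
  · simp only [Function.comp_apply]
    rw [← Real.exp_add]
    congr 1
    push_cast
    ring

end Decay

theorem corollary5p8 (n k m : ℕ) (hn : 1 ≤ n) (hk : 1 ≤ k) (hkm : k ≤ m) (c : ℝ) (hc : 0 < c) :
    ((fun z : Fin n → EuclideanSpace ℂ (Fin m) => connectedCorr k z)
        =o[comap maxDist atTop ⊓ 𝓟 (separated m (Fin n) c)]
      fun z => Real.exp (-(maxDist z ^ 2 / n))) ∧
    (2 ≤ n →
      (fun z : Fin n → EuclideanSpace ℂ (Fin m) => connectedCorr k z)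
          =O[𝓟 (separated m (Fin n) c)]
        fun z => maxDist z ^ (4 * n - 4) * Real.exp (-(maxDist z ^ 2 / ((n : ℝ) - 1)))) := by
  obtain ⟨N, rfl⟩ : ∃ N, n = N + 1 := ⟨n - 1, by omega⟩
  rcases Nat.eq_zero_or_pos N with rfl | hN
  · refine ⟨?_, fun h => absurd h (by norm_num)⟩
    refine (IsLittleO.of_bound fun ε _ => ?_).mono inf_le_left
    -- A single point has $R=0$, so the limit $R\to\infty$ is vacuous.
    filter_upwards [tendsto_comap.eventually_gt_atTop (0 : ℝ)] with z hz
    obtain ⟨p, q, hpq⟩ := exists_dist_eq_maxDist z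
    rw [← hpq, show p = q from Fin.ext (by omega), dist_self] at hz
    exact absurd hz (lt_irrefl 0)
  · have h := connectedCorr_isBigO k m hc hN
    refine ⟨?_, fun _ => ?_⟩
    · exact (h.mono inf_le_right).trans_isLittleO
        (((pow_mul_exp_neg_sq_isLittleO hN).comp_tendsto tendsto_comap).mono inf_le_left)
    · have e1 : 4 * (N + 1) - 4 = 4 * N := by omega
      have e2 : ((N + 1 : ℕ) : ℝ) - 1 = N := by push_cast; ring
      rw [e1, e2]
      exact h
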